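/- Theorem (Incoherence-Induced Phase Transition and Dimensional Trapping in AdamW). Setting. Let $m,n\ge 1$, $D=mn$, $d=\min(m,n)$. Let $W^*,W_0\in\mathbb R^{m\times n}$ with $\|W_0-W^*\|_F<r_0$. The stochastic gradient at step $t\ge 0$ is $G_t=S(W_t)+E_t$. * Signal: $S$ is a measurable map from $\mathbb R^{m\times n}$ to itself. For every $W$ with $\|W-W^*\|_F<r_0$ we have $\|S(W)\|_{op}\le\lambda r_0$, and $S(W)$ has a singular value decomposition $U\Sigma V^\top$ (orthonormal columns, positive singular values) with $\|U\|_{2,\infty}\le\mu_0/\sqrt m$ and $\|V\|_{2,\infty}\le\mu_0/\sqrt n$. * Noise: for a filtration $(\mathcal F_t)$, $E_t$ is $\mathcal F_{t+1}$-measurable, $\mathbb E[E_t\mid\mathcal F_t]=0$, $\mathbb E[E_{t,i}^2\mid\mathcal F_t]=\sigma_i^2$ for each coordinate $i$, and $\|E_t\|_{op}\le B$ almost surely. There is a set $I$ of at least $\rho D$ coordinates with $\sigma_i^2\ge c_0/d$ for $i\in I$. * AdamW with learning rate $\eta>0$, decay rates $\beta_1,\beta_2\in[0,1)$, stability constant $\varepsilon>0$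 and weight decay $\omega\ge0$: $m_0=v_0=0$, $m_{t+1}=\beta_1m_t+(1-\beta_1)G_t$, $v_{t+1}=\beta_2v_t+(1-\beta_2)G_t^{2}$ (coordinatewise), $W_{t+1}=W_t-\eta\,\frac{m_{t+1}}{\sqrt{v_{t+1}}+\varepsilon}-\eta\omega W_t$. Let $m^S_t,m^E_t$ be the exponential moving averages (decay rate $\beta_1$, started at $0$) of $S(W_s)$ and $E_s$, so that $m_t=m^S_t+m^E_t$. Let $v^E_t$ be that of $E_s^2$ with decay rate $\beta_2$. Put $\Delta^{sig}_t=-\eta\, m^S_{t+1}/(\sqrt{v_{t+1}}+\varepsilon)$ and $\Delta^{noise}_t=-\eta\, m^E_{t+1}/(\sqrt{v_{t+1}}+\varepsilon)$. The escape time is $\tau=\inf\{t\ge0:\|W_t-W^*\|_F\ge r_0\}\in\mathbb N\cup\{\infty\}$. For $\theta\in(0,1]$, the learning rate is said to let the signal escape before the noise (at level $\theta$) if the accumulated noise variance satisfies $$\mathbb E\sum_{t<\tau}\sum_{i}\operatorname{Var}\big(\Delta^{noise}_{t,i}\mid\mathcal F_t\big)\le r_0^2$$ and, with probability at least $\theta$,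 either $\tau=\infty$ or $\big\|\sum_{t<\tau}\Delta^{sig}_t\big\|_F\ge\theta r_0$. Claim. For all positive $\lambda,r_0,\mu_0,B,\rho,c_0,\varepsilon$, all $\beta_1,\beta_2\in[0,1)$ and all $\theta\in(0,1]$ there are constants $c,C>0$, depending only on these numbers (and not on $m,n,\eta,\omega,W^*,W_0,S$ or the law of the noise), such that in every such setting the following holds. (1) (Asymmetric energy decay) If $\|W-W^*\|_F<r_0$, then $S(W)_i^2\le C/D$ for every coordinate $i$, and $S(W)_i^2\le\frac Cd\sigma_i^2$ for $i\in I$. The average of $\sigma_i^2$ over all coordinates is at most $C/d$. For $i\in I$ and $t\ge1$, the second-moment estimator is dominated by noise: $\mathbb E[v^E_{t,i}]\ge c/d$ and $\mathbb E\big[|v_{t,i}-v^E_{t,i}|\,\mathbf 1_{t\le\tau}\big]\le\frac{C}{\sqrt d}\,\mathbb E[v^E_{t,i}]$. (2) (Dimensional trapping) For every $t\ge 0$, almost surely $\|\Delta^{sig}_t\|_F\le C\eta$ on $\{t<\tau\}$, while $\mathbb E\big[\|\Delta^{noise}_t\|_F^2\mathbf 1_{t<\tau}\big]\ge c\,\eta^2\sqrt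 D\;\mathbb P(t<\tau)$. If the learning rate lets the signal escape before the noise at level $\theta$, then $$\eta\le\frac{C}{\sqrt D}\qquad\text{and}\qquad\mathbb E[\tau]\ge c\,D^{1/2}.$$ -/

import Mathlib

open MeasureTheory ProbabilityTheory
open scoped ENNReal

noncomputable section

namespace AdamEscape

/-- Real `m × n` matrices; the parameter space has dimension `D = m * n`. -/
abbrev Mat (m n : ℕ) := Matrix (Fin m) (Fin n) ℝ

/-- The Frobenius norm. -/
def frob {m n : ℕ} (A : Mat m n) : ℝ := √(∑ i, ∑ j, A i j ^ 2)

/-- The spectral (Euclidean operator) norm. -/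
def opNorm {m n : ℕ} (A : Mat m n) : ℝ :=
  ‖LinearMap.toContinuousLinearMap (Matrix.toEuclideanLin A)‖

/-- `A` has a compact singular value decomposition `U diag(s) Vᵀ` (orthonormal columns, positive
singular values) whose factors satisfy `‖U‖_{2,∞} ≤ μ₀ / √m` and `‖V‖_{2,∞} ≤ μ₀ / √n`.
Summing the squared rows shows that the rank `r` is then at most `μ₀ ^ 2`. -/
def IsIncoherent {m n : ℕ} (μ₀ : ℝ) (A : Mat m n) : Prop :=
  ∃ (r : ℕ) (U : Mat m r) (V : Mat n r) (s : Fin r → ℝ),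
    U.transpose * U = 1 ∧ V.transpose * V = 1 ∧ (∀ k, 0 < s k) ∧
    A = U * Matrix.diagonal s * V.transpose ∧
    (∀ i, √(∑ k, U i k ^ 2) ≤ μ₀ / √(m : ℝ)) ∧
    (∀ j, √(∑ k, V j k ^ 2) ≤ μ₀ / √(n : ℝ))

/-- The structural drift `S` near the saddle `Wstar`: inside the Taylor neighbourhood of radius
`r₀` the drift is an incoherent low-rank matrix of spectral norm at most `lam * r₀`, where `-lam` is
the negative curvature. -/
structure IncoherentDrift {m n : ℕ} (lam r₀ μ₀ : ℝ) (Wstar : Mat m n) (S : Mat m n → Mat m n) :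
    Prop where
  measurable : ∀ i j, Measurable fun x : Fin m → Fin n → ℝ => S (Matrix.of x) i j
  incoherent : ∀ W, frob (W - Wstar) < r₀ → IsIncoherent μ₀ (S W)
  opNorm_le : ∀ W, frob (W - Wstar) < r₀ → opNorm (S W) ≤ lam * r₀

/-- Heteroskedastic noise: `E t`, the noise of step `t`, is revealed between times `t` and `t + 1`,
has zero conditional mean, coordinatewise (conditional) variance `σ²`, and spectral norm at most
`B`. The entries of `E t` may be dependent and need not be symmetric. -/
structure HeteroNoise {m n : ℕ} {Ω : Type*} [mΩ : MeasurableSpace Ω] (μ : Measure Ω)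
    (ℱ : Filtration ℕ mΩ) (B : ℝ) (σsq : Fin m → Fin n → ℝ) (E : ℕ → Ω → Mat m n) : Prop where
  adapted : ∀ t i j, StronglyMeasurable[ℱ (t + 1)] fun ω => E t ω i j
  opNorm_le : ∀ t, ∀ᵐ ω ∂μ, opNorm (E t ω) ≤ B
  mean_zero : ∀ t i j, μ[fun ω => E t ω i j | ℱ t] =ᵐ[μ] fun _ => 0
  variance : ∀ t i j, μ[fun ω => E t ω i j ^ 2 | ℱ t] =ᵐ[μ] fun _ => σsq i j

/-- The noise is non-degenerate on the set `I` of coordinates, which makes up at least a fraction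
`ρ` of all `D = m * n` coordinates: there the variance is at least `c₀ / d`, `d = min m n`. -/
structure NonDegenerateOn {m n : ℕ} (ρ c₀ : ℝ) (σsq : Fin m → Fin n → ℝ)
    (I : Finset (Fin m × Fin n)) : Prop where
  card_ge : ρ * ((m : ℝ) * n) ≤ I.card
  variance_ge : ∀ p ∈ I, c₀ / (min m n : ℕ) ≤ σsq p.1 p.2

/-- Hyperparameters of AdamW: learning rate, decay rates of the two moment estimators, stability
constant of the denominator, and decoupled weight decay. -/
structure Hyper where
  η : ℝ
  β₁ : ℝ
  β₂ : ℝ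
  ε : ℝ
  wd : ℝ

/-- State of AdamW: parameters, first moment, second moment. -/
structure State (m n : ℕ) where
  W : Mat m n
  M : Mat m n
  V : Mat m n

/-- One AdamW step with stochastic gradient `g`. -/
def State.step {m n : ℕ} (h : Hyper) (x : State m n) (g : Mat m n) : State m n :=
  let M' : Mat m n := Matrix.of fun i j => h.β₁ * x.M i j + (1 - h.β₁) * g i j
  let V' : Mat m n := Matrix.of fun i j => h.β₂ * x.V i j + (1 - h.β₂) * g i j ^ 2
  { W := Matrix.of fun i j =>
      x.W i j - h.η * (M' i j / (√(V' i j) + h.ε)) - h.η * h.wd * x.W i j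
    M := M'
    V := V' }

/-- The AdamW trajectory from `W₀` along the noise path `e`; the gradient seen at step `t` is
`S (W t) + e t`. -/
def traj {m n : ℕ} (h : Hyper) (S : Mat m n → Mat m n) (W₀ : Mat m n) (e : ℕ → Mat m n) :
    ℕ → State m n
  | 0 => ⟨W₀, 0, 0⟩
  | t + 1 => (traj h S W₀ e t).step h (S (traj h S W₀ e t).W + e t)

/-- Exponential moving average started at `0`; `ema β x t` involves `x 0, …, x (t - 1)`. -/
def ema (β : ℝ) (x : ℕ → ℝ) : ℕ → ℝ
  | 0 => 0
  | t + 1 => β * ema β x t + (1 - β) * x t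

section Path

variable {m n : ℕ} (h : Hyper) (S : Mat m n → Mat m n) (W₀ : Mat m n) (e : ℕ → Mat m n)

/-- Signal part of the update of step `t`: the moving average of the drift over the AdamW
denominator. -/
def sigStep (t : ℕ) : Mat m n := Matrix.of fun i j =>
  -h.η * (ema h.β₁ (fun s => S (traj h S W₀ e s).W i j) (t + 1) /
    (√((traj h S W₀ e (t + 1)).V i j) + h.ε))

/-- Noise part of the update of step `t`: the moving average of the noise over the AdamW
denominator. -/
def noiseStep (t : ℕ) : Mat m n := Matrix.of fun i j =>
  -h.η * (ema h.β₁ (fun s => e s i j) (t + 1) /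
    (√((traj h S W₀ e (t + 1)).V i j) + h.ε))

/-- Structural progress: the displacement accumulated by the signal parts of the first `t` steps. -/
def sigDisp (t : ℕ) : Mat m n := ∑ s ∈ Finset.range t, sigStep h S W₀ e s

/-- What the second-moment estimator would be if the gradient consisted of the noise alone. -/
def noiseV (t : ℕ) (i : Fin m) (j : Fin n) : ℝ := ema h.β₂ (fun s => e s i j ^ 2) t

/-- The geometric escape time `inf {t ≥ 0 : ‖W t - Wstar‖_F ≥ r₀}`, with value `⊤` if the trajectory
never leaves the neighbourhood. -/
def escapeTime (Wstar : Mat m n) (r₀ : ℝ) : ℕ∞ :=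
  ⨅ t ∈ {t : ℕ | r₀ ≤ frob ((traj h S W₀ e t).W - Wstar)}, (t : ℕ∞)

theorem traj_M_eq (t : ℕ) (i : Fin m) (j : Fin n) :
    (traj h S W₀ e t).M i j =
      ema h.β₁ (fun s => S (traj h S W₀ e s).W i j) t + ema h.β₁ (fun s => e s i j) t := by
  induction t with
  | zero => simp [traj, ema]
  | succ t ih =>
    simp only [traj, ema, State.step, Matrix.of_apply, Matrix.add_apply, ih]
    ring

/-- An AdamW update is its signal part plus its noise part plus the weight decay. -/
theorem traj_W_succ (t : ℕ) :
    (traj h S W₀ e (t + 1)).W = (traj h S W₀ e t).W + sigStep h S W₀ e t + noiseStep h S W₀ e t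
      - (h.η * h.wd) • (traj h S W₀ e t).W := by
  ext i j
  have hM := traj_M_eq h S W₀ e (t + 1) i j
  have hW : (traj h S W₀ e (t + 1)).W i j = (traj h S W₀ e t).W i j
      - h.η * ((traj h S W₀ e (t + 1)).M i j / (√((traj h S W₀ e (t + 1)).V i j) + h.ε))
      - h.η * h.wd * (traj h S W₀ e t).W i j := rfl
  rw [hW, hM]
  simp only [sigStep, noiseStep, Matrix.sub_apply, Matrix.add_apply, Matrix.of_apply,
    Matrix.smul_apply, smul_eq_mul]
  ring

end Path

/-- Noise variance accumulated over all coordinates up to a random time `τ`: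
`E ∑_{t < τ} ∑_{i,j} Var(ΔW^noise_{t,ij} | ℱ t)`. -/
def accNoiseVar {m n : ℕ} {Ω : Type*} [mΩ : MeasurableSpace Ω] (μ : Measure Ω)
    (ℱ : Filtration ℕ mΩ) (h : Hyper) (S : Mat m n → Mat m n) (W₀ : Mat m n)
    (E : ℕ → Ω → Mat m n) (τ : Ω → ℕ∞) : ℝ≥0∞ :=
  ∑' t : ℕ, ∫⁻ ω in {ω | (t : ℕ∞) < τ ω},
    ENNReal.ofReal (∑ i, ∑ j,
      (Var[fun ω' => noiseStep h S W₀ (fun s => E s ω') t i j; μ | ℱ t]) ω) ∂μ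

/-- The requirement on the step size, with success level `θ`: the noise variance accumulated before
the escape does not exceed the squared radius `r₀ ^ 2`, and with probability at least `θ` the
escape comes with structural progress, i.e. at the escape time the signal displacement is at least
`θ * r₀`. -/
structure SignalEscapesBeforeNoise {m n : ℕ} {Ω : Type*} [mΩ : MeasurableSpace Ω] (μ : Measure Ω)
    (ℱ : Filtration ℕ mΩ) (h : Hyper) (S : Mat m n → Mat m n) (Wstar W₀ : Mat m n)
    (E : ℕ → Ω → Mat m n) (r₀ θ : ℝ) : Prop where
  noise_le : accNoiseVar μ ℱ h S W₀ E (fun ω => escapeTime h S W₀ (fun s => E s ω) Wstar r₀)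
    ≤ ENNReal.ofReal (r₀ ^ 2)
  signal_ge : ENNReal.ofReal θ ≤
    μ {ω | ∀ t : ℕ, escapeTime h S W₀ (fun s => E s ω) Wstar r₀ = t →
      θ * r₀ ≤ frob (sigDisp h S W₀ (fun s => E s ω) t)}

end AdamEscape

end

open MeasureTheory ProbabilityTheory
open scoped ENNReal

noncomputable section

namespace AdamEscape

/-! Incoherence spreads the drift evenly: inside the neighbourhood each entry is at most `K / √D`
with `K = lam * r₀ * μ₀ ^ 2`. The noise, bounded only in spectral norm, has total energy between
orders `√D` and `d`: at most `d B²`, while on `I` at least `ρ D c₀ / d ≥ ρ c₀ √D`, because `d ≤ √D`.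
Before the escape the AdamW denominators lie between `ε` and `K + B + ε`, so they change these
orders only by constants. A signal step has norm at most `η K / ε`; a noise step has mean square at
least of order `η² √D`.

The escape is then a budget argument. Progress `θ r₀` requires `N ≥ θ r₀ ε / (K η)` steps, so with
probability at least `θ` the trajectory stays that long. If each step costs conditional variance `v
η² √D`, the budget gives `v η² √D θ N ≤ r₀²`, hence `η = O(1/√D)`. Consequently `N`, and with it
`E[τ] ≥ θ N`, is at least of order `√D`.

The delicate point is the conditional variance of a single step: the fresh noise also enters the
denominator and may be asymmetric, so the quotient need not be monotone in it. `quotient_mono`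
recovers strong monotonicity about zero where the old noise average is small, and
`le_condVar_of_monotone` turns this into a variance bound. The spectral bound leaves at most `d B² /
δ²` coordinates with an average above the threshold `δ`, negligible against `ρ D` in high dimension.
In low dimension the first step alone suffices, since its old average is zero. -/

/-! ### Spectral norm, energy and entries of incoherent matrices. -/

theorem frob_sq {m n : ℕ} (A : Mat m n) : frob A ^ 2 = ∑ i, ∑ j, A i j ^ 2 :=
  Real.sq_sqrt (by positivity)

theorem opNorm_nonneg {m n : ℕ} (A : Mat m n) : 0 ≤ opNorm A := norm_nonneg _

/-- The defining bound of the spectral norm, in coordinates. -/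
theorem sum_mulVec_sq_le {m n : ℕ} (A : Mat m n) (x : Fin n → ℝ) :
    ∑ i, (∑ j, A i j * x j) ^ 2 ≤ opNorm A ^ 2 * ∑ j, x j ^ 2 := by
  have h := (LinearMap.toContinuousLinearMap (Matrix.toEuclideanLin A)).le_opNorm
    (WithLp.toLp 2 x)
  have h2 := pow_le_pow_left₀ (norm_nonneg _) h 2
  rw [mul_pow, EuclideanSpace.norm_sq_eq, EuclideanSpace.norm_sq_eq] at h2
  simpa [Matrix.toLpLin_apply, Matrix.mulVec, dotProduct, opNorm, sq_abs] using h2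

theorem col_sq_le {m n : ℕ} (A : Mat m n) (j : Fin n) : ∑ i, A i j ^ 2 ≤ opNorm A ^ 2 := by
  simpa [Pi.single_apply] using sum_mulVec_sq_le A (Pi.single j 1)

theorem row_sq_le {m n : ℕ} (A : Mat m n) (i : Fin m) : ∑ j, A i j ^ 2 ≤ opNorm A ^ 2 := by
  -- Testing on the row itself gives `‖row‖⁴ ≤ ‖A‖² ‖row‖²`, which avoids passing to the transpose.
  have h := sum_mulVec_sq_le A (A i)
  have h1 := Finset.single_le_sum (f := fun i' => (∑ j, A i' j * A i j) ^ 2)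
    (fun _ _ => sq_nonneg _) (Finset.mem_univ i)
  have h2 : ∑ j, A i j * A i j = ∑ j, A i j ^ 2 := by simp only [sq]
  simp only [h2] at h1
  have h3 : 0 ≤ ∑ j, A i j ^ 2 := by positivity
  rcases h3.eq_or_lt with h0 | h0
  · rw [← h0]; positivity
  · refine le_of_mul_le_mul_right ?_ h0
    nlinarith

theorem abs_entry_le {m n : ℕ} (A : Mat m n) (i : Fin m) (j : Fin n) : |A i j| ≤ opNorm A := by
  refine abs_le_of_sq_le_sq ?_ (opNorm_nonneg A)
  exact (Finset.single_le_sum (f := fun i => A i j ^ 2) (fun _ _ => sq_nonneg _)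
    (Finset.mem_univ i)).trans (col_sq_le A j)

/-- Summing the row or column bound over the shorter side gives the factor `d` instead of `D`. This
caps both the average noise variance and the number of coordinates with a large noise average. -/
theorem sum_sq_le_min_mul {m n : ℕ} (A : Mat m n) :
    ∑ i, ∑ j, A i j ^ 2 ≤ (min m n : ℕ) * opNorm A ^ 2 := by
  rcases min_choice m n with h | h <;> rw [h]
  · simpa using Finset.sum_le_sum fun i (_ : i ∈ Finset.univ) => row_sq_le A i
  · rw [Finset.sum_comm]
    simpa using Finset.sum_le_sum fun j (_ : j ∈ Finset.univ) => col_sq_le A j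

/-- The identity `A V = U diag(s)` bounds every singular value by the spectral norm. Cauchy–Schwarz
between a row of `U` and a row of `V` then bounds the entry, with no factor of the rank. -/
theorem IsIncoherent.abs_entry_le {m n : ℕ} {μ₀ : ℝ} {A : Mat m n} (hA : IsIncoherent μ₀ A)
    (i : Fin m) (j : Fin n) :
    |A i j| ≤ opNorm A * μ₀ ^ 2 / √((m : ℝ) * n) := by
  obtain ⟨r, U, V, s, hU, hV, hs, hA, hUr, hVr⟩ := hA
  have hAV : A * V = U * Matrix.diagonal s := by
    rw [hA, Matrix.mul_assoc, hV, Matrix.mul_one]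
  have hsle : ∀ k, s k ≤ opNorm A := by
    intro k
    have h := sum_mulVec_sq_le A (fun j => V j k)
    have hVk : ∑ j, V j k ^ 2 = 1 := by
      have := congrFun (congrFun hV k) k
      simpa [Matrix.mul_apply, sq] using this
    have hUk : ∑ i, U i k ^ 2 = 1 := by
      have := congrFun (congrFun hU k) k
      simpa [Matrix.mul_apply, sq] using this
    have hi : ∀ i, ∑ j, A i j * V j k = U i k * s k := by
      intro i
      have := congrFun (congrFun hAV i) k
      rwa [Matrix.mul_diagonal, Matrix.mul_apply] at this
    simp only [hi, mul_pow, ← Finset.sum_mul, hVk, hUk, one_mul, mul_one] at h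
    exact (pow_le_pow_iff_left₀ (hs k).le (opNorm_nonneg A) two_ne_zero).1 h
  have hent : A i j = ∑ k, s k * (U i k * V j k) := by
    conv_lhs => rw [hA]
    rw [Matrix.mul_apply]
    simp only [Matrix.mul_diagonal, Matrix.transpose_apply]
    exact Finset.sum_congr rfl fun k _ => by ring
  calc |A i j| ≤ ∑ k, opNorm A * (|U i k| * |V j k|) := by
        rw [hent]
        refine (Finset.abs_sum_le_sum_abs _ _).trans (Finset.sum_le_sum fun k _ => ?_)
        rw [abs_mul, abs_mul, abs_of_pos (hs k)]
        exact mul_le_mul_of_nonneg_right (hsle k) (by positivity)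
    _ = opNorm A * ∑ k, |U i k| * |V j k| := by rw [Finset.mul_sum]
    _ ≤ opNorm A * (√(∑ k, U i k ^ 2) * √(∑ k, V j k ^ 2)) := by
        refine mul_le_mul_of_nonneg_left ?_ (opNorm_nonneg A)
        simpa [sq_abs] using Real.sum_mul_le_sqrt_mul_sqrt Finset.univ
          (fun k => |U i k|) (fun k => |V j k|)
    _ ≤ opNorm A * (μ₀ / √m * (μ₀ / √n)) := by
        refine mul_le_mul_of_nonneg_left ?_ (opNorm_nonneg A)
        exact mul_le_mul (hUr i) (hVr j) (Real.sqrt_nonneg _) ((Real.sqrt_nonneg _).trans (hUr i))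
    _ = opNorm A * μ₀ ^ 2 / √((m : ℝ) * n) := by
        rw [Real.sqrt_mul (Nat.cast_nonneg m)]
        ring

theorem IncoherentDrift.abs_entry_le {m n : ℕ} {lam r₀ μ₀ : ℝ} {Wstar : Mat m n}
    {S : Mat m n → Mat m n} (hS : IncoherentDrift lam r₀ μ₀ Wstar S) {W : Mat m n}
    (hW : frob (W - Wstar) < r₀) (i : Fin m) (j : Fin n) :
    |S W i j| ≤ lam * r₀ * μ₀ ^ 2 / √((m : ℝ) * n) := by
  refine ((hS.incoherent W hW).abs_entry_le i j).trans ?_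
  have := hS.opNorm_le W hW
  gcongr

/-! ### Exponential moving averages -/

section Ema

variable {β : ℝ} {x y : ℕ → ℝ} {t : ℕ}

theorem ema_const (β b : ℝ) (t : ℕ) : ema β (fun _ => b) t = (1 - β ^ t) * b := by
  induction t with
  | zero => simp [ema]
  | succ t ih => rw [ema, ih]; ring

theorem ema_mono (h0 : 0 ≤ β) (h1 : β ≤ 1) (hxy : ∀ s < t, x s ≤ y s) :
    ema β x t ≤ ema β y t := by
  induction t with
  | zero => simp [ema]
  | succ t ih =>
    exact add_le_add (mul_le_mul_of_nonneg_left (ih fun s hs => hxy s (by omega)) h0)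
      (mul_le_mul_of_nonneg_left (hxy t (by omega)) (by linarith))

theorem ema_sub (β : ℝ) (x y : ℕ → ℝ) (t : ℕ) :
    ema β (fun s => x s - y s) t = ema β x t - ema β y t := by
  induction t with
  | zero => simp [ema]
  | succ t ih => rw [ema, ema, ema, ih]; ring

theorem ema_sum {ι : Type*} (u : Finset ι) (β : ℝ) (x : ι → ℕ → ℝ) (t : ℕ) :
    ema β (fun s => ∑ p ∈ u, x p s) t = ∑ p ∈ u, ema β (x p) t := by
  induction t with
  | zero => simp [ema]
  | succ t ih => simp only [ema, ih, Finset.mul_sum, Finset.sum_add_distrib]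

theorem ema_nonneg (h0 : 0 ≤ β) (h1 : β ≤ 1) (hx : ∀ s < t, 0 ≤ x s) : 0 ≤ ema β x t := by
  simpa [ema_const] using ema_mono (x := fun _ => 0) h0 h1 hx

theorem ema_le_of_le {b : ℝ} (h0 : 0 ≤ β) (h1 : β ≤ 1) (hb : 0 ≤ b) (hx : ∀ s < t, x s ≤ b) :
    ema β x t ≤ b := by
  refine (ema_mono (y := fun _ => b) h0 h1 hx).trans ?_
  rw [ema_const]
  nlinarith [pow_nonneg h0 t]

theorem abs_ema_le (h0 : 0 ≤ β) (h1 : β ≤ 1) : |ema β x t| ≤ ema β (fun s => |x s|) t := by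
  induction t with
  | zero => simp [ema]
  | succ t ih =>
    rw [ema, ema]
    refine (abs_add_le _ _).trans ?_
    rw [abs_mul, abs_mul, abs_of_nonneg h0, abs_of_nonneg (sub_nonneg.2 h1)]
    gcongr

theorem abs_ema_le_of_le {b : ℝ} (h0 : 0 ≤ β) (h1 : β ≤ 1) (hb : 0 ≤ b)
    (hx : ∀ s < t, |x s| ≤ b) : |ema β x t| ≤ b :=
  (abs_ema_le h0 h1).trans (ema_le_of_le h0 h1 hb hx)

/-- Convexity of the square; the defect of one step is `β (1 - β) (ema - x)²`. -/
theorem ema_sq_le (h0 : 0 ≤ β) (h1 : β ≤ 1) : ema β x t ^ 2 ≤ ema β (fun s => x s ^ 2) t := by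
  induction t with
  | zero => simp [ema]
  | succ t ih =>
    rw [ema, ema]
    nlinarith [mul_le_mul_of_nonneg_left ih h0,
      mul_nonneg (mul_nonneg h0 (sub_nonneg.2 h1)) (sq_nonneg (ema β x t - x t))]

end Ema

/-! ### Deterministic facts about the trajectory -/

/-- The admissible hyperparameters. -/
structure Hyper.Valid (h : Hyper) : Prop where
  η_pos : 0 < h.η
  β₁_nonneg : 0 ≤ h.β₁
  β₁_lt : h.β₁ < 1
  β₂_nonneg : 0 ≤ h.β₂
  β₂_lt : h.β₂ < 1
  ε_pos : 0 < h.ε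

section Deterministic

variable {m n : ℕ} {h : Hyper} {S : Mat m n → Mat m n} {W₀ Wstar : Mat m n} {e : ℕ → Mat m n}
  {r₀ K B : ℝ} {t : ℕ}

/-- Two versions are needed: the second moment at time `t` has seen only the drift at times `s < t`,
whereas the update of step `t` also sees the drift at time `t` and so requires the strict
inequality. -/
theorem le_escapeTime_iff :
    (t : ℕ∞) ≤ escapeTime h S W₀ e Wstar r₀ ↔
      ∀ s < t, frob ((traj h S W₀ e s).W - Wstar) < r₀ := by
  simp only [escapeTime, le_iInf₂_iff, Set.mem_ofPred_eq, Nat.cast_le]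
  refine forall_congr' fun s => ?_
  rw [← not_lt, ← not_lt, not_imp_not]

theorem lt_escapeTime_iff :
    (t : ℕ∞) < escapeTime h S W₀ e Wstar r₀ ↔
      ∀ s ≤ t, frob ((traj h S W₀ e s).W - Wstar) < r₀ := by
  rw [← ENat.add_one_le_iff (ENat.natCast_ne_top t)]
  have := le_escapeTime_iff (h := h) (S := S) (W₀ := W₀) (e := e) (Wstar := Wstar) (r₀ := r₀)
    (t := t + 1)
  simpa only [Nat.cast_add, Nat.cast_one, Nat.lt_succ_iff] using this

theorem traj_V_eq (t : ℕ) (i : Fin m) (j : Fin n) :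
    (traj h S W₀ e t).V i j =
      ema h.β₂ (fun s => (S (traj h S W₀ e s).W i j + e s i j) ^ 2) t := by
  induction t with
  | zero => simp [traj, ema]
  | succ t ih =>
    simp only [traj, ema, State.step, Matrix.of_apply, Matrix.add_apply, ih]

theorem traj_V_nonneg (hh : h.Valid) (t : ℕ) (i : Fin m) (j : Fin n) :
    0 ≤ (traj h S W₀ e t).V i j := by
  rw [traj_V_eq]
  exact ema_nonneg hh.β₂_nonneg hh.β₂_lt.le fun _ _ => sq_nonneg _

theorem traj_V_succ (t : ℕ) (i : Fin m) (j : Fin n) :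
    (traj h S W₀ e (t + 1)).V i j = h.β₂ * (traj h S W₀ e t).V i j +
      (1 - h.β₂) * (S (traj h S W₀ e t).W i j + e t i j) ^ 2 := rfl

theorem traj_V_le (hh : h.Valid)
    (hK : ∀ W, frob (W - Wstar) < r₀ → ∀ i j, |S W i j| ≤ K) (he : ∀ s i j, |e s i j| ≤ B)
    (hτ : ∀ s < t, frob ((traj h S W₀ e s).W - Wstar) < r₀) (i : Fin m) (j : Fin n) :
    (traj h S W₀ e t).V i j ≤ (K + B) ^ 2 := by
  rw [traj_V_eq]
  refine ema_le_of_le hh.β₂_nonneg hh.β₂_lt.le (sq_nonneg _) fun s hs => ?_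
  refine sq_le_sq' ?_ ?_ <;>
    linarith [abs_le.1 (hK _ (hτ s hs) i j), abs_le.1 (he s i j)]

/-- Isolates the fresh noise `e t`, which occurs in the numerator and in the denominator; all else
is known at time `t`. -/
theorem noiseStep_eq (t : ℕ) (i : Fin m) (j : Fin n) :
    noiseStep h S W₀ e t i j = -h.η * ((h.β₁ * ema h.β₁ (fun s => e s i j) t +
      (1 - h.β₁) * e t i j) / (√(h.β₂ * (traj h S W₀ e t).V i j +
      (1 - h.β₂) * (S (traj h S W₀ e t).W i j + e t i j) ^ 2) + h.ε)) := rfl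

theorem abs_div_sqrt_add_le {x b v ε : ℝ} (hx : |x| ≤ b) (hε : 0 < ε) :
    |x / (√v + ε)| ≤ b / ε := by
  have h0 := Real.sqrt_nonneg v
  rw [abs_div, abs_of_pos (by linarith : 0 < √v + ε)]
  have hb := (abs_nonneg x).trans hx
  gcongr
  linarith

theorem abs_noiseStep_le (hh : h.Valid) (hB : 0 ≤ B) (he : ∀ s i j, |e s i j| ≤ B) (t : ℕ)
    (i : Fin m) (j : Fin n) : |noiseStep h S W₀ e t i j| ≤ h.η * (B / h.ε) := by
  rw [noiseStep, Matrix.of_apply, abs_mul, abs_neg, abs_of_pos hh.η_pos]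
  exact mul_le_mul_of_nonneg_left (abs_div_sqrt_add_le (abs_ema_le_of_le hh.β₁_nonneg
    hh.β₁_lt.le hB fun s _ => he s i j) hh.ε_pos) hh.η_pos.le

/-- Before the escape the entries of a signal step are at most `η K / ε`. -/
theorem frob_sigStep_le (hh : h.Valid) (hK0 : 0 ≤ K)
    (hK : ∀ W, frob (W - Wstar) < r₀ → ∀ i j, |S W i j| ≤ K / √((m : ℝ) * n))
    (hτ : (t : ℕ∞) < escapeTime h S W₀ e Wstar r₀) :
    frob (sigStep h S W₀ e t) ≤ K / h.ε * h.η := by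
  rw [lt_escapeTime_iff] at hτ
  have hη := hh.η_pos
  have hε := hh.ε_pos
  have hent : ∀ i j, sigStep h S W₀ e t i j ^ 2 ≤ (K / h.ε * h.η) ^ 2 / ((m : ℝ) * n) := by
    intro i j
    have h1 : |sigStep h S W₀ e t i j| ≤ h.η * (K / √((m : ℝ) * n) / h.ε) := by
      rw [sigStep, Matrix.of_apply, abs_mul, abs_neg, abs_of_pos hη]
      exact mul_le_mul_of_nonneg_left (abs_div_sqrt_add_le (abs_ema_le_of_le hh.β₁_nonneg
        hh.β₁_lt.le (by positivity) fun s hs => hK _ (hτ s (by omega)) i j) hε) hη.le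
    refine (sq_le_sq' (neg_le_of_abs_le h1) (le_of_abs_le h1)).trans_eq ?_
    rw [mul_pow, div_pow, div_pow, Real.sq_sqrt (by positivity)]
    ring
  rw [frob]
  refine Real.sqrt_le_iff.2 ⟨by positivity, ?_⟩
  refine (Finset.sum_le_sum fun i _ => Finset.sum_le_sum fun j _ => hent i j).trans ?_
  simp only [Finset.sum_const, Finset.card_univ, Fintype.card_fin, nsmul_eq_mul]
  rw [← mul_assoc]
  rcases eq_or_ne ((m : ℝ) * n) 0 with h0 | h0
  · rw [h0, zero_mul]
    positivity
  · rw [mul_div_cancel₀ _ h0]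

/-- Lets `frob` inherit the triangle inequality from Euclidean space. -/
theorem frob_eq_norm (A : Mat m n) :
    frob A = ‖(WithLp.toLp 2 fun p : Fin m × Fin n => A p.1 p.2 :
      EuclideanSpace ℝ (Fin m × Fin n))‖ := by
  rw [EuclideanSpace.norm_eq, frob, Fintype.sum_prod_type]
  simp [sq_abs]

theorem frob_sum_le {ι : Type*} (u : Finset ι) (A : ι → Mat m n) :
    frob (∑ s ∈ u, A s) ≤ ∑ s ∈ u, frob (A s) := by
  simp only [frob_eq_norm]
  refine le_trans (le_of_eq ?_) (norm_sum_le u _)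
  congr 1
  ext p
  simp [Matrix.sum_apply]

theorem frob_sigDisp_le (hh : h.Valid) (hK0 : 0 ≤ K)
    (hK : ∀ W, frob (W - Wstar) < r₀ → ∀ i j, |S W i j| ≤ K / √((m : ℝ) * n))
    (hτ : (t : ℕ∞) ≤ escapeTime h S W₀ e Wstar r₀) :
    frob (sigDisp h S W₀ e t) ≤ t * (K / h.ε * h.η) := by
  refine (frob_sum_le _ _).trans ((Finset.sum_le_card_nsmul _ _ _ fun s hs => ?_).trans_eq
    (by rw [Finset.card_range, nsmul_eq_mul]))
  refine frob_sigStep_le hh hK0 hK (lt_of_lt_of_le ?_ hτ)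
  exact_mod_cast Finset.mem_range.1 hs

end Deterministic

/-! ### The quotient of the noise average by the denominator -/

/-- As a function of `y`, `√(c + l y²)` is the Euclidean norm of `(√c, √l y)`, hence Lipschitz with
constant `√l ≤ 1`. -/
theorem sqrt_add_mul_sq_le {c l : ℝ} (hc : 0 ≤ c) (hl : 0 ≤ l) (hl1 : l ≤ 1) (s x : ℝ) :
    √(c + l * (s + x) ^ 2) ≤ √(c + l * s ^ 2) + |x| := by
  have h0 : 0 ≤ c + l * s ^ 2 := by positivity
  have h1 : |l * s| ≤ √(c + l * s ^ 2) := by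
    refine Real.abs_le_sqrt ?_
    nlinarith [mul_nonneg (mul_nonneg hl (sub_nonneg.2 hl1)) (sq_nonneg s)]
  refine Real.sqrt_le_iff.2 ⟨by positivity, ?_⟩
  have h2 : l * s * x ≤ √(c + l * s ^ 2) * |x| :=
    (le_abs_self _).trans (by rw [abs_mul]; gcongr)
  nlinarith [Real.sq_sqrt h0, sq_abs x, mul_nonneg (sub_nonneg.2 hl1) (sq_nonneg x)]

/-- If the old noise average `a` is small, the quotient is strongly monotone in the fresh noise `x`
around `x = 0`. -/
theorem quotient_mono {c l a k ε R s x : ℝ} (hc : 0 ≤ c) (hl : 0 ≤ l) (hl1 : l ≤ 1) (hε : 0 < ε)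
    (hk : 0 ≤ k) (ha : |a| ≤ k * ε / 2) (hR : √(c + l * (s + x) ^ 2) + ε ≤ R)
    (hR' : √(c + l * s ^ 2) + ε ≤ R) :
    k * ε / (2 * R ^ 2) * x ^ 2 ≤
      ((a + k * x) / (√(c + l * (s + x) ^ 2) + ε) - a / (√(c + l * s ^ 2) + ε)) * x := by
  have h1 := sqrt_add_mul_sq_le hc hl hl1 s x
  have h2 := sqrt_add_mul_sq_le hc hl hl1 (s + x) (-x)
  rw [add_neg_cancel_right, abs_neg] at h2
  have p := Real.sqrt_nonneg (c + l * (s + x) ^ 2)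
  have q := Real.sqrt_nonneg (c + l * s ^ 2)
  set P := √(c + l * (s + x) ^ 2)
  set Q := √(c + l * s ^ 2)
  have hP : 0 < P + ε := by linarith
  have hQ : 0 < Q + ε := by linarith
  have hRpos : 0 < R := by linarith
  have hPQ : (P + ε) * (Q + ε) ≤ R ^ 2 := by rw [sq]; gcongr
  -- Over the common denominator the difference of quotients is `k (Q + ε) x - a (P - Q)`. Its
  -- second term, due to the moving denominator, consumes at most half of `k ε x²` after
  -- multiplication by `x`.
  have h3 : a * (P - Q) * x ≤ k * ε / 2 * x ^ 2 := by
    have : |P - Q| ≤ |x| := abs_le.2 ⟨by linarith, by linarith⟩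
    calc a * (P - Q) * x ≤ |a * (P - Q) * x| := le_abs_self _
      _ = |a| * |P - Q| * |x| := by rw [abs_mul, abs_mul]
      _ ≤ k * ε / 2 * |x| * |x| := by gcongr
      _ = k * ε / 2 * x ^ 2 := by rw [mul_assoc, ← sq, sq_abs]
  have h4 : k * ε / 2 * x ^ 2 ≤ (k * (Q + ε) * x - a * (P - Q)) * x := by
    nlinarith [mul_nonneg (mul_nonneg hk q) (sq_nonneg x)]
  calc k * ε / (2 * R ^ 2) * x ^ 2 = (k * ε / 2 * x ^ 2) / R ^ 2 := by field_simp
    _ ≤ (k * ε / 2 * x ^ 2) / ((P + ε) * (Q + ε)) := by gcongr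
    _ ≤ ((k * (Q + ε) * x - a * (P - Q)) * x) / ((P + ε) * (Q + ε)) := by gcongr
    _ = _ := by field_simp; ring

/-! ### Conditional moments -/

/-- If `X` dominates `κ e² + g e` on a past event, with `g` known in the past and `e` conditionally
centred, then the conditional expectation of `X` dominates `κ E[e² | 𝒢]` there. -/
theorem le_condExp_of_quadratic_le {Ω : Type*} {𝒢 mΩ : MeasurableSpace Ω} (hm : 𝒢 ≤ mΩ)
    {μ : Measure Ω} [IsProbabilityMeasure μ] {X e g : Ω → ℝ} {v κ b : ℝ} {A : Set Ω}
    (hA : MeasurableSet[𝒢] A) (hX : Integrable X μ) (he : Integrable e μ)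
    (he2 : Integrable (fun ω => e ω ^ 2) μ) (hg : StronglyMeasurable[𝒢] g)
    (hgb : ∀ᵐ ω ∂μ, |g ω| ≤ b) (h1 : μ[e | 𝒢] =ᵐ[μ] fun _ => 0)
    (h2 : μ[fun ω => e ω ^ 2 | 𝒢] =ᵐ[μ] fun _ => v)
    (hle : ∀ᵐ ω ∂μ, ω ∈ A → κ * e ω ^ 2 + g ω * e ω ≤ X ω) :
    ∀ᵐ ω ∂μ, ω ∈ A → κ * v ≤ (μ[X | 𝒢]) ω := by
  have hge : Integrable (g * e) μ :=
    he.bdd_mul (c := b) (hg.mono hm).aestronglyMeasurable hgb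
  have hk : Integrable (κ • fun ω => e ω ^ 2) μ := he2.smul κ
  have hY : Integrable ((κ • fun ω => e ω ^ 2) + g * e) μ := hk.add hge
  have hmono : A.indicator ((κ • fun ω => e ω ^ 2) + g * e) ≤ᵐ[μ] A.indicator X := by
    filter_upwards [hle] with ω hω
    by_cases hωA : ω ∈ A
    · simpa [hωA] using hω hωA
    · simp [hωA]
  have hc := condExp_mono (m := 𝒢) (hY.indicator (hm _ hA)) (hX.indicator (hm _ hA)) hmono
  filter_upwards [hc, condExp_indicator hY hA, condExp_indicator hX hA, condExp_add hk hge 𝒢,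
    condExp_smul κ (fun ω => e ω ^ 2) 𝒢 (μ := μ), h1, h2,
    condExp_stronglyMeasurable_mul_of_bound hm hg he b hgb] with ω c1 c2 c3 c4 c5 c6 c7 c8 hωA
  rw [c2, c3, Set.indicator_of_mem hωA, Set.indicator_of_mem hωA, c4, Pi.add_apply, c5, c8,
    Pi.smul_apply, Pi.mul_apply, c6, c7] at c1
  simpa using c1

/-- A conditional variance bound for a random variable strongly monotone in conditionally centred
noise. -/
theorem le_condVar_of_monotone {Ω : Type*} {𝒢 mΩ : MeasurableSpace Ω} (hm : 𝒢 ≤ mΩ)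
    {μ : Measure Ω} [IsProbabilityMeasure μ] {X e g : Ω → ℝ} {v κ b : ℝ} {A : Set Ω}
    (hA : MeasurableSet[𝒢] A) (hX : AEStronglyMeasurable X μ)
    (hXb : ∀ᵐ ω ∂μ, |X ω| ≤ b) (he : Integrable e μ)
    (he2 : Integrable (fun ω => e ω ^ 2) μ) (hg : StronglyMeasurable[𝒢] g)
    (hgb : ∀ᵐ ω ∂μ, |g ω| ≤ b) (h1 : μ[e | 𝒢] =ᵐ[μ] fun _ => 0)
    (h2 : μ[fun ω => e ω ^ 2 | 𝒢] =ᵐ[μ] fun _ => v) (hκ : 0 ≤ κ)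
    (hle : ∀ᵐ ω ∂μ, ω ∈ A → (X ω - g ω) * e ω ≤ -(κ * e ω ^ 2)) :
    ∀ᵐ ω ∂μ, ω ∈ A → κ ^ 2 * v ≤ (Var[X; μ | 𝒢]) ω := by
  have hXbar : ∀ᵐ ω ∂μ, |(μ[X | 𝒢]) ω| ≤ b :=
    ae_bdd_abs_condExp_of_ae_bdd_abs hXb
  -- Write `X̄` for the conditional mean. Expanding `(X - X̄ + κ e)² ≥ 0` and using the monotonicity
  -- yields `(X - X̄)² ≥ κ² e² + 2 κ (X̄ - g) e`; the linear term has conditional mean zero.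
  refine le_condExp_of_quadratic_le hm (b := 2 * κ * (b + b)) hA ?_ he he2
    (g := fun ω => 2 * κ * ((μ[X | 𝒢]) ω - g ω))
    ((stronglyMeasurable_condExp.sub hg).const_mul _) ?_ h1 h2 ?_
  · refine Integrable.of_bound ((hX.sub (stronglyMeasurable_condExp.mono hm
      ).aestronglyMeasurable).pow 2) ((b + b) ^ 2) ?_
    filter_upwards [hXb, hXbar] with ω h3 h4
    rw [Pi.pow_apply, Pi.sub_apply, norm_pow, Real.norm_eq_abs]
    exact pow_le_pow_left₀ (abs_nonneg _) ((abs_sub _ _).trans (add_le_add h3 h4)) 2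
  · filter_upwards [hgb, hXbar] with ω h3 h4
    rw [abs_mul, abs_of_nonneg (by positivity : 0 ≤ 2 * κ)]
    exact mul_le_mul_of_nonneg_left ((abs_sub _ _).trans (add_le_add h4 h3)) (by positivity)
  · filter_upwards [hle] with ω h3 hωA
    rw [Pi.pow_apply, Pi.sub_apply]
    nlinarith [mul_le_mul_of_nonneg_left (h3 hωA) hκ, sq_nonneg (X ω - (μ[X | 𝒢]) ω + κ * e ω)]

/-! ### Noise moments and the second-moment estimator. -/

section Noise

variable {m n : ℕ} {Ω : Type*} {mΩ : MeasurableSpace Ω} {μ : Measure Ω} {ℱ : Filtration ℕ mΩ}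
  {B : ℝ} {σsq : Fin m → Fin n → ℝ} {E : ℕ → Ω → Mat m n}

theorem HeteroNoise.ae_opNorm_le (hE : HeteroNoise μ ℱ B σsq E) :
    ∀ᵐ ω ∂μ, ∀ t, opNorm (E t ω) ≤ B :=
  ae_all_iff.2 hE.opNorm_le

theorem HeteroNoise.ae_abs_le (hE : HeteroNoise μ ℱ B σsq E) :
    ∀ᵐ ω ∂μ, ∀ t i j, |E t ω i j| ≤ B := by
  filter_upwards [hE.ae_opNorm_le] with ω hω t i j
  exact (abs_entry_le _ i j).trans (hω t)

theorem HeteroNoise.measurable (hE : HeteroNoise μ ℱ B σsq E) (t : ℕ) (i : Fin m) (j : Fin n) :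
    Measurable fun ω => E t ω i j :=
  ((hE.adapted t i j).mono (ℱ.le _)).measurable

theorem HeteroNoise.integrable_pow [IsProbabilityMeasure μ] (hE : HeteroNoise μ ℱ B σsq E) (t : ℕ)
    (i : Fin m) (j : Fin n) (k : ℕ) : Integrable (fun ω => E t ω i j ^ k) μ := by
  refine Integrable.of_bound ((hE.measurable t i j).pow_const k).aestronglyMeasurable (B ^ k) ?_
  filter_upwards [hE.ae_abs_le] with ω hω
  rw [norm_pow]
  exact pow_le_pow_left₀ (abs_nonneg _) (hω t i j) k

theorem HeteroNoise.integrable [IsProbabilityMeasure μ] (hE : HeteroNoise μ ℱ B σsq E) (t : ℕ)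
    (i : Fin m) (j : Fin n) : Integrable (fun ω => E t ω i j) μ := by
  simpa using hE.integrable_pow t i j 1

theorem HeteroNoise.integral_sq [IsProbabilityMeasure μ] (hE : HeteroNoise μ ℱ B σsq E) (t : ℕ)
    (i : Fin m) (j : Fin n) : ∫ ω, E t ω i j ^ 2 ∂μ = σsq i j := by
  rw [← integral_condExp (ℱ.le t), integral_congr_ae (hE.variance t i j)]
  simp

theorem HeteroNoise.σsq_nonneg [IsProbabilityMeasure μ] (hE : HeteroNoise μ ℱ B σsq E)
    (i : Fin m) (j : Fin n) : 0 ≤ σsq i j := by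
  rw [← hE.integral_sq 0]
  exact integral_nonneg fun _ => sq_nonneg _

theorem HeteroNoise.sum_σsq_le [IsProbabilityMeasure μ] (hE : HeteroNoise μ ℱ B σsq E) :
    ∑ i, ∑ j, σsq i j ≤ (min m n : ℕ) * B ^ 2 := by
  have h1 : ∑ i, ∑ j, σsq i j = ∫ ω, ∑ i, ∑ j, E 0 ω i j ^ 2 ∂μ := by
    rw [integral_finsetSum _ fun i _ => integrable_finsetSum _ fun j _ => hE.integrable_pow 0 i j 2]
    refine Finset.sum_congr rfl fun i _ => ?_
    rw [integral_finsetSum _ fun j _ => hE.integrable_pow 0 i j 2]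
    exact Finset.sum_congr rfl fun j _ => (hE.integral_sq 0 i j).symm
  rw [h1]
  have h2 : ∫ _ω, ((min m n : ℕ) * B ^ 2 : ℝ) ∂μ = (min m n : ℕ) * B ^ 2 := by simp
  rw [← h2]
  refine integral_mono_ae (integrable_finsetSum _ fun i _ => integrable_finsetSum _ fun j _ =>
    hE.integrable_pow 0 i j 2) (integrable_const _) ?_
  filter_upwards [hE.ae_opNorm_le] with ω hω
  refine (sum_sq_le_min_mul _).trans ?_
  have := opNorm_nonneg (E 0 ω)
  have := hω 0
  gcongr

/-- The variance of `|E|` is nonnegative. -/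
theorem HeteroNoise.integral_abs_le [IsProbabilityMeasure μ] (hE : HeteroNoise μ ℱ B σsq E)
    (t : ℕ) (i : Fin m) (j : Fin n) : ∫ ω, |E t ω i j| ∂μ ≤ √(σsq i j) := by
  refine Real.le_sqrt_of_sq_le ?_
  have hA := (hE.integrable t i j).abs
  set a := ∫ ω, |E t ω i j| ∂μ
  have h0 : 0 ≤ ∫ ω, (|E t ω i j| - a) ^ 2 ∂μ := integral_nonneg fun _ => sq_nonneg _
  have h1 : ∫ ω, (|E t ω i j| - a) ^ 2 ∂μ = σsq i j - 2 * a * a + a ^ 2 := by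
    have : ∀ ω, (|E t ω i j| - a) ^ 2 = E t ω i j ^ 2 - 2 * a * |E t ω i j| + a ^ 2 := by
      intro ω; rw [sub_sq, sq_abs]; ring
    simp only [this]
    have h2 : Integrable (fun ω => E t ω i j ^ 2 - 2 * a * |E t ω i j|) μ :=
      (hE.integrable_pow t i j 2).sub (hA.const_mul _)
    rw [integral_add h2 (integrable_const _),
      integral_sub (hE.integrable_pow t i j 2) (hA.const_mul _), integral_const_mul,
      hE.integral_sq]
    simp [a]
  nlinarith

theorem integrable_ema {x : ℕ → Ω → ℝ} (hx : ∀ s, Integrable (x s) μ) (β : ℝ) (t : ℕ) :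
    Integrable (fun ω => ema β (fun s => x s ω) t) μ := by
  induction t with
  | zero => simp [ema]
  | succ t ih => exact (ih.const_mul _).add ((hx t).const_mul _)

theorem integral_ema {x : ℕ → Ω → ℝ} (hx : ∀ s, Integrable (x s) μ) (β : ℝ) (t : ℕ) :
    ∫ ω, ema β (fun s => x s ω) t ∂μ = ema β (fun s => ∫ ω, x s ω ∂μ) t := by
  induction t with
  | zero => simp [ema]
  | succ t ih =>
    simp only [ema]
    rw [integral_add ((integrable_ema hx β t).const_mul _) ((hx t).const_mul _),
      integral_const_mul, integral_const_mul, ih]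

theorem measurable_ema {x : ℕ → Ω → ℝ} (hx : ∀ s, Measurable[ℱ (s + 1)] (x s)) (β : ℝ) (t : ℕ) :
    Measurable[ℱ t] fun ω => ema β (fun s => x s ω) t := by
  induction t with
  | zero => exact measurable_const
  | succ t ih => exact ((ih.mono (ℱ.mono t.le_succ) le_rfl).const_mul _).add ((hx t).const_mul _)

theorem HeteroNoise.lintegral_noiseV [IsProbabilityMeasure μ] (hE : HeteroNoise μ ℱ B σsq E)
    {h : Hyper} (hh : h.Valid) (t : ℕ) (i : Fin m) (j : Fin n) :
    ∫⁻ ω, ENNReal.ofReal (noiseV h (fun s => E s ω) t i j) ∂μ =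
      ENNReal.ofReal ((1 - h.β₂ ^ t) * σsq i j) := by
  rw [← ofReal_integral_eq_lintegral_ofReal]
  · simp only [noiseV]
    rw [integral_ema fun s => hE.integrable_pow s i j 2]
    simp only [hE.integral_sq, ema_const]
  · exact integrable_ema (fun s => hE.integrable_pow s i j 2) _ _
  · exact ae_of_all _ fun ω => ema_nonneg hh.β₂_nonneg hh.β₂_lt.le fun _ _ => sq_nonneg _

/-- Before the escape the second-moment estimator is close to its noise part. -/
theorem HeteroNoise.setLIntegral_abs_V_sub_le [IsProbabilityMeasure μ]
    (hE : HeteroNoise μ ℱ B σsq E) {h : Hyper} (hh : h.Valid) {S : Mat m n → Mat m n}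
    {W₀ Wstar : Mat m n} {r₀ K : ℝ} (hK0 : 0 ≤ K)
    (hK : ∀ W, frob (W - Wstar) < r₀ → ∀ i j, |S W i j| ≤ K) (t : ℕ) (i : Fin m) (j : Fin n) :
    ∫⁻ ω in {ω | (t : ℕ∞) ≤ escapeTime h S W₀ (fun s => E s ω) Wstar r₀}, ENNReal.ofReal
        |(traj h S W₀ (fun s => E s ω) t).V i j - noiseV h (fun s => E s ω) t i j| ∂μ ≤
      ENNReal.ofReal ((1 - h.β₂ ^ t) * (2 * K * √(σsq i j) + K ^ 2)) := by
  -- Majorant of `|(a + e)² - e²|` for a drift entry `|a| ≤ K`. It does not involve the trajectory,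
  -- so the restriction to the event can be dropped before integrating.
  set x : ℕ → Ω → ℝ := fun s ω => 2 * K * |E s ω i j| + K ^ 2
  have hx : ∀ s, Integrable (x s) μ := fun s =>
    ((hE.integrable s i j).abs.const_mul _).add (integrable_const _)
  have hmeas : Measurable fun ω => ema h.β₂ (fun s => x s ω) t := by
    refine (measurable_ema (ℱ := ℱ) (fun s => ?_) h.β₂ t).mono (ℱ.le t) le_rfl
    exact ((measurable_norm.comp (hE.adapted s i j).measurable).const_mul _).add_const _
  calc _ ≤ ∫⁻ ω in {ω | (t : ℕ∞) ≤ escapeTime h S W₀ (fun s => E s ω) Wstar r₀},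
        ENNReal.ofReal (ema h.β₂ (fun s => x s ω) t) ∂μ := by
        refine setLIntegral_mono hmeas.ennreal_ofReal fun ω hω => ENNReal.ofReal_le_ofReal ?_
        have hω' := le_escapeTime_iff.1 hω
        rw [traj_V_eq, noiseV, ← ema_sub]
        refine (abs_ema_le hh.β₂_nonneg hh.β₂_lt.le).trans
          (ema_mono hh.β₂_nonneg hh.β₂_lt.le fun s hs => ?_)
        have h1 := hK _ (hω' s hs) i j
        set a := S (traj h S W₀ (fun s => E s ω) s).W i j
        have h2 : (a + E s ω i j) ^ 2 - E s ω i j ^ 2 = 2 * a * E s ω i j + a ^ 2 := by ring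
        rw [h2]
        refine (abs_add_le _ _).trans ?_
        rw [abs_mul, abs_mul, abs_two, abs_pow]
        simp only [x]
        gcongr
    _ ≤ ∫⁻ ω, ENNReal.ofReal (ema h.β₂ (fun s => x s ω) t) ∂μ := setLIntegral_le_lintegral _ _
    _ = ENNReal.ofReal (ema h.β₂ (fun s => ∫ ω, x s ω ∂μ) t) := by
        rw [← ofReal_integral_eq_lintegral_ofReal (integrable_ema hx _ _), integral_ema hx]
        exact ae_of_all _ fun ω => ema_nonneg hh.β₂_nonneg hh.β₂_lt.le fun _ _ => by
          simp only [x]; positivity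
    _ ≤ _ := by
        refine ENNReal.ofReal_le_ofReal ?_
        rw [← ema_const]
        refine ema_mono hh.β₂_nonneg hh.β₂_lt.le fun s _ => ?_
        simp only [x]
        rw [integral_add ((hE.integrable s i j).abs.const_mul _) (integrable_const _),
          integral_const_mul]
        simpa using mul_le_mul_of_nonneg_left (hE.integral_abs_le s i j)
          (by positivity : 0 ≤ 2 * K)

end Noise

/-! ### Lower bounds on the noise before the escape -/

theorem const_mul_le_setLIntegral {Ω : Type*} {mΩ : MeasurableSpace Ω} {μ : Measure Ω} {A : Set Ω}
    (hA : MeasurableSet A) {f : Ω → ℝ≥0∞} {c : ℝ≥0∞} (h : ∀ᵐ ω ∂μ, ω ∈ A → c ≤ f ω) :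
    c * μ A ≤ ∫⁻ ω in A, f ω ∂μ := by
  rw [← setLIntegral_const]
  exact setLIntegral_mono_ae' hA h

/-- This is `d ≤ √D`, the source of `√D` in the noise bounds: `D / d ≥ √D`. -/
theorem min_mul_sqrt_le (m n : ℕ) : ((min m n : ℕ) : ℝ) * √((m : ℝ) * n) ≤ (m : ℝ) * n := by
  have h1 : ((min m n : ℕ) : ℝ) ≤ √((m : ℝ) * n) := by
    refine Real.le_sqrt_of_sq_le ?_
    rw [sq]
    exact mul_le_mul (by exact_mod_cast min_le_left m n) (by exact_mod_cast min_le_right m n)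
      (Nat.cast_nonneg _) (Nat.cast_nonneg _)
  calc _ ≤ √((m : ℝ) * n) * √((m : ℝ) * n) := by gcongr
    _ = _ := Real.mul_self_sqrt (by positivity)

/-- A positive fraction of the coordinates in `I` carries noise variance of order `√D`. -/
theorem NonDegenerateOn.le_sum {m n : ℕ} {ρ c₀ x : ℝ} {σsq : Fin m → Fin n → ℝ}
    {I : Finset (Fin m × Fin n)} (hI : NonDegenerateOn ρ c₀ σsq I) (hm : 1 ≤ m) (hn : 1 ≤ n)
    (hc₀ : 0 ≤ c₀) (hx : 0 ≤ x) {G : Finset (Fin m × Fin n)} (hG : G ⊆ I)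
    (hcard : x * ((m : ℝ) * n) ≤ G.card) :
    x * c₀ * √((m : ℝ) * n) ≤ ∑ p ∈ G, σsq p.1 p.2 := by
  have hd : (0 : ℝ) < (min m n : ℕ) := by exact_mod_cast Nat.lt_of_lt_of_le one_pos (le_min hm hn)
  calc x * c₀ * √((m : ℝ) * n) ≤ x * ((m : ℝ) * n) * (c₀ / (min m n : ℕ)) := by
        rw [mul_div_assoc', le_div_iff₀ hd]
        nlinarith [mul_le_mul_of_nonneg_left (min_mul_sqrt_le m n) (mul_nonneg hx hc₀)]
    _ ≤ G.card * (c₀ / (min m n : ℕ)) := by gcongr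
    _ ≤ _ := by
        rw [← nsmul_eq_mul]
        exact Finset.card_nsmul_le_sum _ _ _ fun p hp => hI.variance_ge p (hG hp)

theorem measurable_comp_entries {Ω : Type*} {𝒢 : MeasurableSpace Ω} {m n : ℕ}
    {f : (Fin m → Fin n → ℝ) → ℝ} (hf : Measurable f) {W : Ω → Mat m n}
    (hW : ∀ i j, Measurable fun ω => W ω i j) : Measurable fun ω => f (W ω) :=
  hf.comp (measurable_pi_lambda _ fun i => measurable_pi_lambda _ fun j => hW i j)

section NoiseLowerBounds

variable {m n : ℕ} {Ω : Type*} {mΩ : MeasurableSpace Ω} {μ : Measure Ω}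
  {ℱ : Filtration ℕ mΩ} {B K r₀ : ℝ} {σsq : Fin m → Fin n → ℝ} {E : ℕ → Ω → Mat m n} {h : Hyper}
  {S : Mat m n → Mat m n} {W₀ Wstar : Mat m n}

theorem HeteroNoise.measurable_traj (hE : HeteroNoise μ ℱ B σsq E)
    (hS : ∀ i j, Measurable fun x : Fin m → Fin n → ℝ => S (Matrix.of x) i j) (t : ℕ) :
    (∀ i j, Measurable[ℱ t] fun ω => (traj h S W₀ (fun s => E s ω) t).W i j) ∧
    (∀ i j, Measurable[ℱ t] fun ω => (traj h S W₀ (fun s => E s ω) t).M i j) ∧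
    (∀ i j, Measurable[ℱ t] fun ω => (traj h S W₀ (fun s => E s ω) t).V i j) ∧
    (∀ i j, Measurable[ℱ t] fun ω => S (traj h S W₀ (fun s => E s ω) t).W i j) := by
  suffices H : (∀ i j, Measurable[ℱ t] fun ω => (traj h S W₀ (fun s => E s ω) t).W i j) ∧
      (∀ i j, Measurable[ℱ t] fun ω => (traj h S W₀ (fun s => E s ω) t).M i j) ∧
      (∀ i j, Measurable[ℱ t] fun ω => (traj h S W₀ (fun s => E s ω) t).V i j) by
    refine ⟨H.1, H.2.1, H.2.2, fun i j => ?_⟩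
    exact measurable_comp_entries (hS i j) H.1
  induction t with
  | zero => exact ⟨fun _ _ => measurable_const, fun _ _ => measurable_const,
      fun _ _ => measurable_const⟩
  | succ t ih =>
    have hle := ℱ.mono t.le_succ
    have hSW : ∀ i j, Measurable[ℱ (t + 1)] fun ω => S (traj h S W₀ (fun s => E s ω) t).W i j :=
      fun i j => (measurable_comp_entries (hS i j) ih.1).mono hle le_rfl
    have hg : ∀ i j, Measurable[ℱ (t + 1)] fun ω =>
        S (traj h S W₀ (fun s => E s ω) t).W i j + E t ω i j :=
      fun i j => (hSW i j).add (hE.adapted t i j).measurable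
    have hM : ∀ i j, Measurable[ℱ (t + 1)] fun ω =>
        (traj h S W₀ (fun s => E s ω) (t + 1)).M i j :=
      fun i j => (((ih.2.1 i j).mono hle le_rfl).const_mul _).add ((hg i j).const_mul _)
    have hV : ∀ i j, Measurable[ℱ (t + 1)] fun ω =>
        (traj h S W₀ (fun s => E s ω) (t + 1)).V i j :=
      fun i j => (((ih.2.2 i j).mono hle le_rfl).const_mul _).add
        (((hg i j).pow_const 2).const_mul _)
    have hW : ∀ i j, Measurable[ℱ (t + 1)] fun ω => (traj h S W₀ (fun s => E s ω) t).W i j :=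
      fun i j => (ih.1 i j).mono hle le_rfl
    exact ⟨fun i j => ((hW i j).sub (((hM i j).div ((hV i j).sqrt.add_const _)).const_mul _)).sub
      ((hW i j).const_mul _), hM, hV⟩

/-- Not having escaped by time `t` depends on `W 0, …, W t` only, so the event can be carried
through conditioning on `ℱ t`. -/
theorem HeteroNoise.measurableSet_lt_escapeTime (hE : HeteroNoise μ ℱ B σsq E)
    (hS : ∀ i j, Measurable fun x : Fin m → Fin n → ℝ => S (Matrix.of x) i j) (t : ℕ) :
    MeasurableSet[ℱ t]
      {ω | (t : ℕ∞) < escapeTime h S W₀ (fun s => E s ω) Wstar r₀} := by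
  have h1 : {ω | (t : ℕ∞) < escapeTime h S W₀ (fun s => E s ω) Wstar r₀} =
      ⋂ s ∈ Finset.range (t + 1),
        {ω | frob ((traj h S W₀ (fun s => E s ω) s).W - Wstar) < r₀} := by
    ext ω
    simp [lt_escapeTime_iff]
  rw [h1]
  refine Finset.measurableSet_biInter _ fun s hs => ?_
  have hle := ℱ.mono (Nat.lt_succ_iff.1 (Finset.mem_range.1 hs))
  refine measurableSet_lt (Measurable.sqrt ?_) measurable_const
  refine Finset.measurable_sum _ fun i _ => Finset.measurable_sum _ fun j _ => ?_
  exact ((((hE.measurable_traj hS s).1 i j).mono hle le_rfl).sub_const _).pow_const 2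

theorem HeteroNoise.measurable_ema (hE : HeteroNoise μ ℱ B σsq E) (β : ℝ) (t : ℕ) (i : Fin m)
    (j : Fin n) : Measurable[ℱ t] fun ω => ema β (fun s => E s ω i j) t :=
  AdamEscape.measurable_ema (fun s => (hE.adapted s i j).measurable) β t

/-- The denominator of an AdamW update is bounded before the escape. -/
theorem sqrt_V_add_le {e : ℕ → Mat m n} {t : ℕ} (hh : h.Valid) (hB : 0 ≤ B) (hK0 : 0 ≤ K)
    (hK : ∀ W, frob (W - Wstar) < r₀ → ∀ i j, |S W i j| ≤ K) (he : ∀ s i j, |e s i j| ≤ B)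
    (hτ : (t : ℕ∞) < escapeTime h S W₀ e Wstar r₀) (i : Fin m) (j : Fin n) {x : ℝ}
    (hx : |x| ≤ B) :
    √(h.β₂ * (traj h S W₀ e t).V i j + (1 - h.β₂) * (S (traj h S W₀ e t).W i j + x) ^ 2) + h.ε
      ≤ K + B + h.ε := by
  rw [lt_escapeTime_iff] at hτ
  have h1 := traj_V_le hh hK he (fun s hs => hτ s hs.le) i j
  have h2 : (S (traj h S W₀ e t).W i j + x) ^ 2 ≤ (K + B) ^ 2 := by
    refine sq_le_sq' ?_ ?_ <;>
      linarith [abs_le.1 (hK _ (hτ t le_rfl) i j), abs_le.1 hx]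
  refine add_le_add (Real.sqrt_le_iff.2 ⟨by positivity, ?_⟩) le_rfl
  nlinarith [mul_le_mul_of_nonneg_left h1 hh.β₂_nonneg,
    mul_le_mul_of_nonneg_left h2 (sub_nonneg.2 hh.β₂_lt.le)]

variable [IsProbabilityMeasure μ]

/-- As long as the old noise average of a coordinate is small, the noise step of that coordinate has
conditional variance of order `η² σ²`. -/
theorem HeteroNoise.le_condVar_noiseStep (hE : HeteroNoise μ ℱ B σsq E) (hh : h.Valid)
    (hS : ∀ i j, Measurable fun x : Fin m → Fin n → ℝ => S (Matrix.of x) i j)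
    (hB : 0 ≤ B) (hK0 : 0 ≤ K) (hK : ∀ W, frob (W - Wstar) < r₀ → ∀ i j, |S W i j| ≤ K)
    (t : ℕ) (i : Fin m) (j : Fin n) :
    ∀ᵐ ω ∂μ, ω ∈ {ω | (t : ℕ∞) < escapeTime h S W₀ (fun s => E s ω) Wstar r₀} ∩
        {ω | |h.β₁ * ema h.β₁ (fun s => E s ω i j) t| ≤ (1 - h.β₁) * h.ε / 2} →
      (h.η * ((1 - h.β₁) * h.ε / (2 * (K + B + h.ε) ^ 2))) ^ 2 * σsq i j ≤
        (Var[fun ω' => noiseStep h S W₀ (fun s => E s ω') t i j; μ | ℱ t]) ω := by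
  have hη := hh.η_pos
  have hε := hh.ε_pos
  have hk : 0 ≤ 1 - h.β₁ := sub_nonneg.2 hh.β₁_lt.le
  have hem := hE.measurable_ema h.β₁ t i j
  obtain ⟨-, -, hV, hSW⟩ := hE.measurable_traj (h := h) (W₀ := W₀) hS t
  obtain ⟨-, -, hV', -⟩ := hE.measurable_traj (h := h) (W₀ := W₀) hS (t + 1)
  -- The comparison variable `g` is the noise step with the fresh noise set to zero in numerator and
  -- denominator.
  refine le_condVar_of_monotone (ℱ.le t) (b := h.η * (B / h.ε)) (e := fun ω => E t ω i j)
    (g := fun ω => -h.η * (h.β₁ * ema h.β₁ (fun s => E s ω i j) t /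
      (√(h.β₂ * (traj h S W₀ (fun s => E s ω) t).V i j +
        (1 - h.β₂) * S (traj h S W₀ (fun s => E s ω) t).W i j ^ 2) + h.ε)))
    ((hE.measurableSet_lt_escapeTime hS t).inter
      (measurableSet_le (measurable_norm.comp (hem.const_mul _)) measurable_const))
    ?_ ?_ (hE.integrable t i j) (hE.integrable_pow t i j 2) ?_ ?_ (hE.mean_zero t i j)
    (hE.variance t i j) (by positivity) ?_
  · refine Measurable.aestronglyMeasurable ?_
    refine Measurable.mono (ma := ℱ (t + 1)) ?_ (ℱ.le _) le_rfl
    exact ((hE.measurable_ema h.β₁ (t + 1) i j).div ((hV' i j).sqrt.add_const _)).const_mul _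
  · filter_upwards [hE.ae_abs_le] with ω hω
    exact abs_noiseStep_le hh hB hω t i j
  · exact ((hem.const_mul _).div ((((hV i j).const_mul _).add
      (((hSW i j).pow_const 2).const_mul _)).sqrt.add_const _)).const_mul _ |>.stronglyMeasurable
  · filter_upwards [hE.ae_abs_le] with ω hω
    rw [abs_mul, abs_neg, abs_of_pos hη]
    refine mul_le_mul_of_nonneg_left (abs_div_sqrt_add_le ?_ hε) hη.le
    rw [abs_mul, abs_of_nonneg hh.β₁_nonneg]
    exact (mul_le_of_le_one_left (abs_nonneg _) hh.β₁_lt.le).trans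
      (abs_ema_le_of_le hh.β₁_nonneg hh.β₁_lt.le hB fun s _ => hω s i j)
  · filter_upwards [hE.ae_abs_le] with ω hω hA
    have h0 := sqrt_V_add_le hh hB hK0 hK hω hA.1 i j (x := 0) (by simpa using hB)
    rw [add_zero] at h0
    have h1 := quotient_mono
      (mul_nonneg hh.β₂_nonneg (traj_V_nonneg (e := fun s => E s ω) (S := S) (W₀ := W₀) hh t i j))
      (sub_nonneg.2 hh.β₂_lt.le) (by linarith [hh.β₂_nonneg]) hε hk hA.2
      (sqrt_V_add_le hh hB hK0 hK hω hA.1 i j (hω t i j)) h0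
    rw [noiseStep_eq]
    nlinarith [mul_le_mul_of_nonneg_left h1 hη.le]

/-- Before the escape the total conditional variance of a noise step is of order `η² √D`, either at
the first step or in high dimension. -/
theorem HeteroNoise.le_sum_condVar_noiseStep (hE : HeteroNoise μ ℱ B σsq E) (hh : h.Valid)
    (hS : ∀ i j, Measurable fun x : Fin m → Fin n → ℝ => S (Matrix.of x) i j)
    (hB : 0 ≤ B) (hK0 : 0 ≤ K) (hK : ∀ W, frob (W - Wstar) < r₀ → ∀ i j, |S W i j| ≤ K)
    {ρ c₀ : ℝ} {I : Finset (Fin m × Fin n)} (hI : NonDegenerateOn ρ c₀ σsq I) (hm : 1 ≤ m)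
    (hn : 1 ≤ n) (hρ : 0 ≤ ρ) (hc₀ : 0 ≤ c₀) (t : ℕ)
    (ht : t = 0 ∨ 2 * B ^ 2 ≤ ((1 - h.β₁) * h.ε / 2) ^ 2 * ρ * √((m : ℝ) * n)) :
    ∀ᵐ ω ∂μ, (t : ℕ∞) < escapeTime h S W₀ (fun s => E s ω) Wstar r₀ →
      ((1 - h.β₁) * h.ε / (2 * (K + B + h.ε) ^ 2)) ^ 2 * (ρ * c₀ / 2) * h.η ^ 2 *
          √((m : ℝ) * n) ≤
        ∑ i, ∑ j, (Var[fun ω' => noiseStep h S W₀ (fun s => E s ω') t i j; μ | ℱ t]) ω := by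
  have hη := hh.η_pos
  have hδ : 0 < (1 - h.β₁) * h.ε / 2 :=
    half_pos (mul_pos (sub_pos.2 hh.β₁_lt) hh.ε_pos)
  have hnn : ∀ᵐ ω ∂μ, ∀ i j,
      0 ≤ (Var[fun ω' => noiseStep h S W₀ (fun s => E s ω') t i j; μ | ℱ t]) ω :=
    ae_all_iff.2 fun i => ae_all_iff.2 fun j =>
      condExp_nonneg (ae_of_all _ fun ω => sq_nonneg _)
  have hlb := ae_all_iff.2 fun i => ae_all_iff.2 fun j =>
    hE.le_condVar_noiseStep (W₀ := W₀) hh hS hB hK0 hK t i j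
  filter_upwards [hnn, hlb, hE.ae_opNorm_le] with ω h1 h2 h3 hτ
  set δ := (1 - h.β₁) * h.ε / 2
  set κ := (1 - h.β₁) * h.ε / (2 * (K + B + h.ε) ^ 2)
  set a : Fin m × Fin n → ℝ := fun p => h.β₁ * ema h.β₁ (fun s => E s ω p.1 p.2) t
  set G := I.filter fun p => |a p| ≤ δ
  have hcard : ρ / 2 * ((m : ℝ) * n) ≤ G.card := by
    have hsplit : (I.card : ℝ) = G.card + (I.filter fun p => ¬ |a p| ≤ δ).card := by
      exact_mod_cast (Finset.card_filter_add_card_filter_not _).symm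
    have hbad : ((I.filter fun p => ¬ |a p| ≤ δ).card : ℝ) ≤ ρ / 2 * ((m : ℝ) * n) := by
      -- No coordinate is bad at time `0`, since the old average vanishes. Later, a Chebyshev count
      -- against the energy `d B²` leaves at most half of the guaranteed fraction `ρ`.
      rcases ht with rfl | ht
      · have : (I.filter fun p => ¬ |a p| ≤ δ) = ∅ := by
          refine Finset.filter_false_of_mem fun p _ => not_not.2 ?_
          simpa [a, ema] using hδ.le
        rw [this]
        simp only [Finset.card_empty, Nat.cast_zero]
        positivity
      · have hsum : ∑ i, ∑ j, ema h.β₁ (fun s => E s ω i j ^ 2) t ≤ (min m n : ℕ) * B ^ 2 := by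
          simp only [← ema_sum]
          refine ema_le_of_le hh.β₁_nonneg hh.β₁_lt.le (by positivity) fun s _ => ?_
          refine (sum_sq_le_min_mul _).trans ?_
          have := opNorm_nonneg (E s ω)
          have := h3 s
          gcongr
        rw [← Fintype.sum_prod_type'] at hsum
        have hle : ((I.filter fun p => ¬ |a p| ≤ δ).card : ℝ) * δ ^ 2 ≤ (min m n : ℕ) * B ^ 2 := by
          rw [← nsmul_eq_mul]
          refine (Finset.card_nsmul_le_sum _ (fun p => a p ^ 2) _ fun p hp => ?_).trans
            ((Finset.sum_le_sum_of_subset_of_nonneg (Finset.subset_univ _)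
              fun _ _ _ => sq_nonneg _).trans ((Finset.sum_le_sum fun p _ => ?_).trans hsum))
          · rw [← sq_abs (a p)]
            exact pow_le_pow_left₀ hδ.le (not_le.1 (Finset.mem_filter.1 hp).2).le 2
          · refine le_trans ?_ (ema_sq_le hh.β₁_nonneg hh.β₁_lt.le)
            rw [mul_pow]
            exact mul_le_of_le_one_left (sq_nonneg _) (pow_le_one₀ hh.β₁_nonneg hh.β₁_lt.le)
        refine le_of_mul_le_mul_right (hle.trans ?_) (pow_pos hδ 2)
        have h4 := mul_le_mul_of_nonneg_left ht (Nat.cast_nonneg (α := ℝ) (min m n))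
        have h5 := mul_le_mul_of_nonneg_left (min_mul_sqrt_le m n)
          (mul_nonneg (sq_nonneg δ) hρ)
        nlinarith
    have := hI.card_ge
    linarith
  have h6 := hI.le_sum hm hn hc₀ (by positivity) (Finset.filter_subset _ I) hcard
  rw [← Fintype.sum_prod_type'
    (f := fun i j => (Var[fun ω' => noiseStep h S W₀ (fun s => E s ω') t i j; μ | ℱ t]) ω)]
  calc κ ^ 2 * (ρ * c₀ / 2) * h.η ^ 2 * √((m : ℝ) * n)
      = (h.η * κ) ^ 2 * (ρ / 2 * c₀ * √((m : ℝ) * n)) := by ring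
    _ ≤ (h.η * κ) ^ 2 * ∑ p ∈ G, σsq p.1 p.2 := by gcongr
    _ = ∑ p ∈ G, (h.η * κ) ^ 2 * σsq p.1 p.2 := Finset.mul_sum _ _ _
    _ ≤ ∑ p ∈ G, (Var[fun ω' => noiseStep h S W₀ (fun s => E s ω') t p.1 p.2; μ | ℱ t]) ω :=
        Finset.sum_le_sum fun p hp => h2 p.1 p.2 ⟨hτ, (Finset.mem_filter.1 hp).2⟩
    _ ≤ _ := Finset.sum_le_sum_of_subset_of_nonneg (Finset.subset_univ _)
        fun p _ _ => h1 p.1 p.2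

/-- Expanding the square of the average, the cross term with the past is conditionally centred and
the squared past is nonnegative. The old average need not be small here. -/
theorem HeteroNoise.le_setIntegral_ema_sq (hE : HeteroNoise μ ℱ B σsq E) (hh : h.Valid)
    (hB : 0 ≤ B) (t : ℕ) {A : Set Ω} (hA : MeasurableSet[ℱ t] A) (i : Fin m) (j : Fin n) :
    (1 - h.β₁) ^ 2 * σsq i j * μ.real A ≤
      ∫ ω in A, ema h.β₁ (fun s => E s ω i j) (t + 1) ^ 2 ∂μ := by
  have hint : Integrable (fun ω => ema h.β₁ (fun s => E s ω i j) (t + 1) ^ 2) μ := by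
    refine Integrable.of_bound (((hE.measurable_ema h.β₁ (t + 1) i j).mono (ℱ.le _)
      le_rfl).pow_const 2).aestronglyMeasurable (B ^ 2) ?_
    filter_upwards [hE.ae_abs_le] with ω hω
    rw [norm_pow]
    exact pow_le_pow_left₀ (abs_nonneg _)
      (abs_ema_le_of_le hh.β₁_nonneg hh.β₁_lt.le hB fun s _ => hω s i j) 2
  have hk : 0 ≤ 2 * (1 - h.β₁) * h.β₁ :=
    mul_nonneg (mul_nonneg zero_le_two (sub_nonneg.2 hh.β₁_lt.le)) hh.β₁_nonneg
  have hc := le_condExp_of_quadratic_le (ℱ.le t) (κ := (1 - h.β₁) ^ 2)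
    (b := 2 * (1 - h.β₁) * h.β₁ * B)
    (g := fun ω => 2 * (1 - h.β₁) * h.β₁ * ema h.β₁ (fun s => E s ω i j) t) hA hint
    (hE.integrable t i j) (hE.integrable_pow t i j 2)
    ((hE.measurable_ema h.β₁ t i j).const_mul _).stronglyMeasurable (by
      filter_upwards [hE.ae_abs_le] with ω hω
      rw [abs_mul, abs_of_nonneg hk]
      exact mul_le_mul_of_nonneg_left
        (abs_ema_le_of_le hh.β₁_nonneg hh.β₁_lt.le hB fun s _ => hω s i j) hk)
    (hE.mean_zero t i j) (hE.variance t i j) (ae_of_all _ fun ω _ => by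
      rw [ema]
      nlinarith [sq_nonneg (h.β₁ * ema h.β₁ (fun s => E s ω i j) t)])
  rw [← setIntegral_condExp (ℱ.le t) hint hA]
  have h1 : ∫ _ω in A, (1 - h.β₁) ^ 2 * σsq i j ∂μ = (1 - h.β₁) ^ 2 * σsq i j * μ.real A := by
    rw [setIntegral_const, smul_eq_mul, mul_comm]
  rw [← h1]
  refine setIntegral_mono_on_ae (integrable_const _).integrableOn integrable_condExp.integrableOn
    (ℱ.le t _ hA) hc

/-- Before the escape the mean square of a noise step is of order `η² √D`. -/
theorem HeteroNoise.le_setLIntegral_frob_noiseStep (hE : HeteroNoise μ ℱ B σsq E) (hh : h.Valid)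
    (hS : ∀ i j, Measurable fun x : Fin m → Fin n → ℝ => S (Matrix.of x) i j)
    (hB : 0 ≤ B) (hK0 : 0 ≤ K) (hK : ∀ W, frob (W - Wstar) < r₀ → ∀ i j, |S W i j| ≤ K)
    {ρ c₀ : ℝ} {I : Finset (Fin m × Fin n)} (hI : NonDegenerateOn ρ c₀ σsq I) (hm : 1 ≤ m)
    (hn : 1 ≤ n) (hρ : 0 ≤ ρ) (hc₀ : 0 ≤ c₀) (t : ℕ) :
    ENNReal.ofReal (((1 - h.β₁) / (K + B + h.ε)) ^ 2 * (ρ * c₀) * h.η ^ 2 * √((m : ℝ) * n)) *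
        μ {ω | (t : ℕ∞) < escapeTime h S W₀ (fun s => E s ω) Wstar r₀} ≤
      ∫⁻ ω in {ω | (t : ℕ∞) < escapeTime h S W₀ (fun s => E s ω) Wstar r₀}, ENNReal.ofReal
        (frob (noiseStep h S W₀ (fun s => E s ω) t) ^ 2) ∂μ := by
  have hA := hE.measurableSet_lt_escapeTime (h := h) (W₀ := W₀) (Wstar := Wstar) (r₀ := r₀) hS t
  have hη := hh.η_pos
  have hε := hh.ε_pos
  set A := {ω | (t : ℕ∞) < escapeTime h S W₀ (fun s => E s ω) Wstar r₀}
  set X : Fin m × Fin n → Ω → ℝ := fun p ω => ema h.β₁ (fun s => E s ω p.1 p.2) (t + 1) ^ 2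
  have hR : 0 < K + B + h.ε := by positivity
  have hX : ∀ p, Integrable (X p) μ := by
    intro p
    refine Integrable.of_bound (((hE.measurable_ema h.β₁ (t + 1) p.1 p.2).mono (ℱ.le _)
      le_rfl).pow_const 2).aestronglyMeasurable (B ^ 2) ?_
    filter_upwards [hE.ae_abs_le] with ω hω
    rw [norm_pow]
    exact pow_le_pow_left₀ (abs_nonneg _)
      (abs_ema_le_of_le hh.β₁_nonneg hh.β₁_lt.le hB fun s _ => hω s p.1 p.2) 2
  have hsum : ((1 - h.β₁) ^ 2 * (ρ * c₀ * √((m : ℝ) * n))) * μ.real A ≤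
      ∫ ω in A, ∑ p ∈ I, X p ω ∂μ := by
    rw [integral_finsetSum _ fun p _ => (hX p).integrableOn]
    refine le_trans ?_ (Finset.sum_le_sum fun p _ => hE.le_setIntegral_ema_sq hh hB t hA p.1 p.2)
    rw [← Finset.sum_mul, ← Finset.mul_sum]
    gcongr
    exact hI.le_sum hm hn hc₀ hρ subset_rfl hI.card_ge
  calc _ = ENNReal.ofReal ((h.η / (K + B + h.ε)) ^ 2 *
        (((1 - h.β₁) ^ 2 * (ρ * c₀ * √((m : ℝ) * n))) * μ.real A)) := by
        rw [← ofReal_measureReal, ← ENNReal.ofReal_mul (by positivity)]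
        congr 1
        ring
    _ ≤ ENNReal.ofReal (∫ ω in A, (h.η / (K + B + h.ε)) ^ 2 * ∑ p ∈ I, X p ω ∂μ) := by
        rw [integral_const_mul]
        gcongr
    _ = ∫⁻ ω in A, ENNReal.ofReal ((h.η / (K + B + h.ε)) ^ 2 * ∑ p ∈ I, X p ω) ∂μ := by
        refine ofReal_integral_eq_lintegral_ofReal
          ((integrable_finsetSum _ fun p _ => hX p).const_mul _).integrableOn (ae_of_all _ ?_)
        exact fun ω => mul_nonneg (sq_nonneg _) (Finset.sum_nonneg fun p _ => sq_nonneg _)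
    _ ≤ _ := by
        refine setLIntegral_mono_ae' (ℱ.le t _ hA) ?_
        filter_upwards [hE.ae_abs_le] with ω hω hωA
        refine ENNReal.ofReal_le_ofReal ?_
        rw [frob_sq, ← Fintype.sum_prod_type'
          (f := fun i j => noiseStep h S W₀ (fun s => E s ω) t i j ^ 2), Finset.mul_sum]
        refine (Finset.sum_le_sum fun p _ => ?_).trans (Finset.sum_le_sum_of_subset_of_nonneg
          (Finset.subset_univ I) fun _ _ _ => sq_nonneg _)
        have h1 := sqrt_V_add_le hh hB hK0 hK hω hωA p.1 p.2 (hω t p.1 p.2)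
        rw [← traj_V_succ] at h1
        have h2 := Real.sqrt_nonneg ((traj h S W₀ (fun s => E s ω) (t + 1)).V p.1 p.2)
        rw [noiseStep, Matrix.of_apply, mul_pow, neg_sq, div_pow, div_pow, div_mul_eq_mul_div,
          mul_div_assoc]
        simp only [X]
        gcongr

end NoiseLowerBounds

/-! ### The escape of the signal -/

/-- A signal that moves by at most `L` per step and makes progress `θ r₀` with probability `θ` stays
for at least `⌈θ r₀ / L⌉` steps with probability `θ`. -/
theorem SignalEscapesBeforeNoise.le_measure {m n : ℕ} {Ω : Type*} {mΩ : MeasurableSpace Ω}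
    {μ : Measure Ω} {ℱ : Filtration ℕ mΩ} {h : Hyper} {S : Mat m n → Mat m n}
    {Wstar W₀ : Mat m n} {E : ℕ → Ω → Mat m n} {r₀ θ K : ℝ}
    (hesc : SignalEscapesBeforeNoise μ ℱ h S Wstar W₀ E r₀ θ) (hh : h.Valid) (hK0 : 0 < K)
    (hK : ∀ W, frob (W - Wstar) < r₀ → ∀ i j, |S W i j| ≤ K / √((m : ℝ) * n)) :
    ENNReal.ofReal θ ≤ μ {ω | ((⌈θ * r₀ / (K / h.ε * h.η)⌉₊ : ℕ) : ℕ∞) ≤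
      escapeTime h S W₀ (fun s => E s ω) Wstar r₀} := by
  refine hesc.signal_ge.trans (measure_mono fun ω hω => ?_)
  rw [Set.mem_ofPred_eq] at hω ⊢
  have hL : 0 < K / h.ε * h.η := mul_pos (div_pos hK0 hh.ε_pos) hh.η_pos
  cases hτ : escapeTime h S W₀ (fun s => E s ω) Wstar r₀ with
  | top => exact le_top
  | coe t =>
    have h1 := (hω t hτ).trans (frob_sigDisp_le hh hK0.le hK hτ.ge)
    rw [Nat.cast_le, Nat.ceil_le, div_le_iff₀ hL]
    exact h1

/-- The dichotomy behind dimensional trapping: both the learning rate and the residence time are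
restricted once the conditional variance of the noise steps before the escape is at least
`v η² √D`. -/
theorem SignalEscapesBeforeNoise.bounds {m n : ℕ} {Ω : Type*} {mΩ : MeasurableSpace Ω}
    {μ : Measure Ω} [IsProbabilityMeasure μ] {ℱ : Filtration ℕ mΩ} {h : Hyper}
    {S : Mat m n → Mat m n} {Wstar W₀ : Mat m n} {E : ℕ → Ω → Mat m n} {r₀ θ K v X : ℝ}
    (hesc : SignalEscapesBeforeNoise μ ℱ h S Wstar W₀ E r₀ θ) (hh : h.Valid) (hK0 : 0 < K)
    (hK : ∀ W, frob (W - Wstar) < r₀ → ∀ i j, |S W i j| ≤ K / √((m : ℝ) * n))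
    (hr₀ : 0 < r₀) (hθ : 0 < θ) (hv : 0 < v) (hX : 0 < X) (hm : 1 ≤ m) (hn : 1 ≤ n)
    (hW₀ : frob (W₀ - Wstar) < r₀)
    (hmeas : ∀ t : ℕ, MeasurableSet
      {ω | (t : ℕ∞) < escapeTime h S W₀ (fun s => E s ω) Wstar r₀})
    (hvar : ∀ t : ℕ, (t = 0 ∨ X ≤ √((m : ℝ) * n)) →
      ∀ᵐ ω ∂μ, (t : ℕ∞) < escapeTime h S W₀ (fun s => E s ω) Wstar r₀ →
        v * h.η ^ 2 * √((m : ℝ) * n) ≤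
          ∑ i, ∑ j, (Var[fun ω' => noiseStep h S W₀ (fun s => E s ω') t i j; μ | ℱ t]) ω) :
    h.η ≤ (r₀ * (K / h.ε) / (v * θ ^ 2) + r₀ * X / √v) / √((m : ℝ) * n) ∧
    ENNReal.ofReal (min (v * θ ^ 4 / (K / h.ε) ^ 2) (1 / X) * √((m : ℝ) * n)) ≤
      ∫⁻ ω, (escapeTime h S W₀ (fun s => E s ω) Wstar r₀ : ℝ≥0∞) ∂μ := by
  have hη := hh.η_pos
  have hD : (1 : ℝ) ≤ √((m : ℝ) * n) := by
    rw [Real.one_le_sqrt]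
    exact_mod_cast Nat.mul_pos hm hn
  set Q := √((m : ℝ) * n)
  set τ : Ω → ℕ∞ := fun ω => escapeTime h S W₀ (fun s => E s ω) Wstar r₀
  set k := K / h.ε
  have hk : 0 < k := div_pos hK0 hh.ε_pos
  have hstep : ∀ t : ℕ, (t = 0 ∨ X ≤ Q) →
      ENNReal.ofReal (v * h.η ^ 2 * Q) * μ {ω | (t : ℕ∞) < τ ω} ≤
        ∫⁻ ω in {ω | (t : ℕ∞) < τ ω}, ENNReal.ofReal (∑ i, ∑ j,
          (Var[fun ω' => noiseStep h S W₀ (fun s => E s ω') t i j; μ | ℱ t]) ω) ∂μ := by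
    intro t ht
    refine const_mul_le_setLIntegral (hmeas t) ?_
    filter_upwards [hvar t ht] with ω hω hτ
    exact ENNReal.ofReal_le_ofReal (hω hτ)
  -- For `√D ≥ X` every step has the variance bound. Otherwise only step `0` is used: it bounds `η`
  -- by `r₀ / √v`, and `τ ≥ 1` already exceeds `√D / X`.
  rcases le_or_gt X Q with hXQ | hXQ
  · set N := ⌈θ * r₀ / (k * h.η)⌉₊
    have hN : θ * r₀ / (k * h.η) ≤ N := Nat.le_ceil _
    have hPN : ENNReal.ofReal θ ≤ μ {ω | (N : ℕ∞) ≤ τ ω} := hesc.le_measure hh hK0 hK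
    have hnoise : v * h.η ^ 2 * Q * θ * N ≤ r₀ ^ 2 := by
      rw [← ENNReal.ofReal_le_ofReal_iff (by positivity)]
      refine le_trans ?_ ((ENNReal.sum_le_tsum (Finset.range N)).trans hesc.noise_le)
      calc ENNReal.ofReal (v * h.η ^ 2 * Q * θ * N)
          = ∑ _t ∈ Finset.range N, ENNReal.ofReal (v * h.η ^ 2 * Q) * ENNReal.ofReal θ := by
            rw [Finset.sum_const, Finset.card_range, ← ENNReal.ofReal_mul (by positivity),
              ← ENNReal.ofReal_nsmul, nsmul_eq_mul, mul_comm]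
        _ ≤ _ := Finset.sum_le_sum fun t ht => le_trans ?_ (hstep t (Or.inr hXQ))
      gcongr
      refine hPN.trans (measure_mono fun ω (hω : (N : ℕ∞) ≤ τ ω) => lt_of_lt_of_le ?_ hω)
      exact_mod_cast Finset.mem_range.1 ht
    have hη1 : h.η * Q ≤ r₀ * k / (v * θ ^ 2) := by
      have h1 : v * h.η ^ 2 * Q * θ * (θ * r₀ / (k * h.η)) ≤ r₀ ^ 2 :=
        (mul_le_mul_of_nonneg_left hN (by positivity)).trans hnoise
      rw [le_div_iff₀ (by positivity)]
      have h2 : v * h.η ^ 2 * Q * θ * (θ * r₀ / (k * h.η)) =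
          h.η * Q * (v * θ ^ 2) * r₀ / k := by
        field_simp
      rw [h2, div_le_iff₀ hk] at h1
      refine le_of_mul_le_mul_right (h1.trans_eq ?_) hr₀
      ring
    refine ⟨?_, ?_⟩
    · rw [le_div_iff₀ (by positivity)]
      exact hη1.trans (le_add_of_nonneg_right (by positivity))
    · have h3 : v * θ ^ 4 / k ^ 2 * Q ≤ N * θ := by
        refine le_trans ?_ (mul_le_mul_of_nonneg_right hN hθ.le)
        rw [le_div_iff₀ (by positivity)] at hη1
        rw [div_mul_eq_mul_div, div_mul_eq_mul_div, div_le_div_iff₀ (by positivity)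
          (by positivity)]
        calc v * θ ^ 4 * Q * (k * h.η) = (h.η * Q * (v * θ ^ 2)) * (θ ^ 2 * k) := by ring
          _ ≤ (r₀ * k) * (θ ^ 2 * k) := by gcongr
          _ = _ := by ring
      calc _ ≤ ENNReal.ofReal (N * θ) := ENNReal.ofReal_le_ofReal
            ((mul_le_mul_of_nonneg_right (min_le_left _ _) (by positivity)).trans h3)
        _ = (N : ℝ≥0∞) * ENNReal.ofReal θ := by
            rw [ENNReal.ofReal_mul (Nat.cast_nonneg _), ENNReal.ofReal_natCast]
        _ ≤ N * μ {ω | (N : ℕ∞) ≤ τ ω} := by gcongr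
        _ ≤ ∫⁻ ω in {ω | (N : ℕ∞) ≤ τ ω}, (τ ω : ℝ≥0∞) ∂μ := by
            refine const_mul_le_setLIntegral ?_ (ae_of_all _ fun ω (hω : (N : ℕ∞) ≤ τ ω) => ?_)
            -- The event `N + 1 ≤ τ` is `N < τ`; for `N = 0` it is the whole space.
            · cases N with
              | zero => simp
              | succ N => simpa [ENat.add_one_le_iff (ENat.natCast_ne_top N)] using hmeas N
            · exact_mod_cast ENat.toENNReal_le.2 hω
        _ ≤ _ := setLIntegral_le_lintegral _ _
  · have hτ0 : ∀ ω, (0 : ℕ∞) < τ ω := fun ω => by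
      have := (lt_escapeTime_iff (h := h) (S := S) (W₀ := W₀) (e := fun s => E s ω)
        (Wstar := Wstar) (r₀ := r₀) (t := 0)).2 fun s hs => by
          obtain rfl := Nat.le_zero.1 hs
          exact hW₀
      exact_mod_cast this
    refine ⟨?_, ?_⟩
    · have h1 : v * h.η ^ 2 * Q ≤ r₀ ^ 2 := by
        rw [← ENNReal.ofReal_le_ofReal_iff (by positivity)]
        have h2 := (hstep 0 (Or.inl rfl)).trans ((ENNReal.le_tsum 0).trans hesc.noise_le)
        have h3 : {ω | ((0 : ℕ) : ℕ∞) < τ ω} = Set.univ :=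
          Set.eq_univ_of_forall fun ω => by simpa using hτ0 ω
        rwa [h3, measure_univ, mul_one] at h2
      have h2 : h.η ≤ r₀ / √v := by
        rw [le_div_iff₀ (by positivity)]
        refine (pow_le_pow_iff_left₀ (by positivity) hr₀.le two_ne_zero).1 ?_
        rw [mul_pow, Real.sq_sqrt hv.le]
        nlinarith [mul_pos hv (pow_pos hη 2)]
      rw [le_div_iff₀ (by positivity)]
      calc h.η * Q ≤ r₀ / √v * X := by gcongr
        _ = r₀ * X / √v := by ring
        _ ≤ _ := le_add_of_nonneg_left (by positivity)
    · calc _ ≤ ENNReal.ofReal 1 := by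
            refine ENNReal.ofReal_le_ofReal ?_
            refine (mul_le_mul_of_nonneg_right (min_le_right _ _) (by positivity)).trans ?_
            rw [div_mul_eq_mul_div, one_mul, div_le_one hX]
            exact hXQ.le
        _ = ∫⁻ _ω, 1 ∂μ := by simp
        _ ≤ _ := by
            refine lintegral_mono fun ω => ?_
            have := ENat.toENNReal_le.2 (Order.one_le_iff_pos.2 (hτ0 ω))
            simpa using this

/-- Arithmetic of the relative error of the second-moment estimator. -/
theorem relative_error_le {K c₀ d Q v : ℝ} (hK : 0 ≤ K) (hc₀ : 0 < c₀) (hd : 1 ≤ d)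
    (hQ : d ≤ Q) (hv : c₀ / d ≤ v) :
    2 * (K / Q) * √v + (K / Q) ^ 2 ≤ (2 * K / √c₀ + K ^ 2 / c₀) / √d * v := by
  have hd0 : 0 < d := by linarith
  have hQ0 : 0 < Q := by linarith
  have hKQ : K / Q ≤ K / d := by gcongr
  have h1 : √c₀ / √d ≤ √v := by
    rw [← Real.sqrt_div hc₀.le]
    exact Real.sqrt_le_sqrt hv
  have hv0 : 0 < v := (div_pos hc₀ hd0).trans_le hv
  have hsd : 1 ≤ √d := Real.one_le_sqrt.2 hd
  have hsc : 0 < √c₀ := Real.sqrt_pos.2 hc₀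
  have h2 : K / d * √v ≤ K / √c₀ / √d * v := by
    have e1 : K / d * √v = K / √c₀ / √d * √v * (√c₀ / √d) := by
      have : K / d = K / √d / √d := by rw [div_div, Real.mul_self_sqrt hd0.le]
      rw [this]
      field_simp
    have e2 : K / √c₀ / √d * v = K / √c₀ / √d * √v * √v := by
      rw [mul_assoc, Real.mul_self_sqrt hv0.le]
    rw [e1, e2]
    gcongr
  have h3 : (K / d) ^ 2 ≤ K ^ 2 / c₀ / √d * v := by
    calc (K / d) ^ 2 = K ^ 2 / c₀ / d * (c₀ / d) := by field_simp
      _ ≤ K ^ 2 / c₀ / √d * v := by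
        gcongr
        exact Real.sqrt_le_self_iff.2 (Or.inr hd)
  calc 2 * (K / Q) * √v + (K / Q) ^ 2 ≤ 2 * (K / d) * √v + (K / d) ^ 2 := by gcongr
    _ ≤ 2 * (K / √c₀ / √d * v) + K ^ 2 / c₀ / √d * v := by linarith
    _ = _ := by ring

end AdamEscape

end

/-! ### Choice of the constants and assembly. -/

theorem mainTheorem2
    (lam r₀ μ₀ B ρ c₀ β₁ β₂ ε θ : ℝ)
    (hlam : 0 < lam) (hr₀ : 0 < r₀) (hμ₀ : 0 < μ₀) (hB : 0 < B) (hρ : 0 < ρ) (hc₀ : 0 < c₀)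
    (hβ₁ : 0 ≤ β₁) (hβ₁' : β₁ < 1) (hβ₂ : 0 ≤ β₂) (hβ₂' : β₂ < 1) (hε : 0 < ε)
    (hθ : 0 < θ) (hθ' : θ ≤ 1) :
    ∃ c C : ℝ, 0 < c ∧ 0 < C ∧
      ∀ (m n : ℕ), 1 ≤ m → 1 ≤ n →
      ∀ (Ω : Type*) (mΩ : MeasurableSpace Ω) (μ : Measure Ω) (_ : IsProbabilityMeasure μ)
        (ℱ : Filtration ℕ mΩ) (Wstar W₀ : AdamEscape.Mat m n)
        (S : AdamEscape.Mat m n → AdamEscape.Mat m n) (E : ℕ → Ω → AdamEscape.Mat m n)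
        (σsq : Fin m → Fin n → ℝ) (I : Finset (Fin m × Fin n)) (η wd : ℝ),
        AdamEscape.IncoherentDrift lam r₀ μ₀ Wstar S →
        AdamEscape.HeteroNoise μ ℱ B σsq E →
        AdamEscape.NonDegenerateOn ρ c₀ σsq I →
        AdamEscape.frob (W₀ - Wstar) < r₀ →
        0 < η → 0 ≤ wd →
        let D : ℝ := (m : ℝ) * n
        let d : ℝ := (min m n : ℕ)
        let h : AdamEscape.Hyper := ⟨η, β₁, β₂, ε, wd⟩
        let τ : Ω → ℕ∞ := fun ω => AdamEscape.escapeTime h S W₀ (fun s => E s ω) Wstar r₀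
        -- (1) signal energy of order `1/D` in every coordinate
        (∀ W, AdamEscape.frob (W - Wstar) < r₀ → ∀ i j, S W i j ^ 2 ≤ C / D) ∧
        -- average noise variance of order `1/d`
        ((∑ i, ∑ j, σsq i j) / D ≤ C / d) ∧
        -- collapse of the signal-to-noise ratio on the coordinates in `I`
        (∀ W, AdamEscape.frob (W - Wstar) < r₀ → ∀ p ∈ I,
          S W p.1 p.2 ^ 2 ≤ C / d * σsq p.1 p.2) ∧
        -- noise part of the second-moment estimator of order at least `1/d`, and the estimator
        -- differs from its noise part by a relative error of order `1/√d`
        (∀ p ∈ I, ∀ t : ℕ, 1 ≤ t →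
          ENNReal.ofReal (c / d) ≤
            ∫⁻ ω, ENNReal.ofReal (AdamEscape.noiseV h (fun s => E s ω) t p.1 p.2) ∂μ ∧
          ∫⁻ ω in {ω | (t : ℕ∞) ≤ τ ω}, ENNReal.ofReal
              |(AdamEscape.traj h S W₀ (fun s => E s ω) t).V p.1 p.2
                - AdamEscape.noiseV h (fun s => E s ω) t p.1 p.2| ∂μ
            ≤ ENNReal.ofReal (C / √d) *
              ∫⁻ ω, ENNReal.ofReal (AdamEscape.noiseV h (fun s => E s ω) t p.1 p.2) ∂μ) ∧
        -- (2) before the escape, signal steps are of size `O(η)` while noise steps have mean square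
        -- of order at least `η² √D`
        (∀ t : ℕ,
          (∀ᵐ ω ∂μ, (t : ℕ∞) < τ ω →
            AdamEscape.frob (AdamEscape.sigStep h S W₀ (fun s => E s ω) t) ≤ C * η) ∧
          ENNReal.ofReal (c * η ^ 2 * √D) * μ {ω | (t : ℕ∞) < τ ω} ≤
            ∫⁻ ω in {ω | (t : ℕ∞) < τ ω}, ENNReal.ofReal
              (AdamEscape.frob (AdamEscape.noiseStep h S W₀ (fun s => E s ω) t) ^ 2) ∂μ) ∧
        -- dimensional restriction of the learning rate and lower bound on the residence time
        (AdamEscape.SignalEscapesBeforeNoise μ ℱ h S Wstar W₀ E r₀ θ →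
          η ≤ C / √D ∧
          ENNReal.ofReal (c * √D) ≤ ∫⁻ ω, (τ ω : ℝ≥0∞) ∂μ) := by
  have hK : 0 < lam * r₀ * μ₀ ^ 2 := by positivity
  have hk₁ : 0 < 1 - β₁ := sub_pos.2 hβ₁'
  have hk₂ : 0 < 1 - β₂ := sub_pos.2 hβ₂'
  set K := lam * r₀ * μ₀ ^ 2 
  have hR : 0 < K + B + ε := by positivity
  set c₁ := (1 - β₂) * c₀
  set c₂ := ((1 - β₁) / (K + B + ε)) ^ 2 * (ρ * c₀)
  set v := ((1 - β₁) * ε / (2 * (K + B + ε) ^ 2)) ^ 2 * (ρ * c₀ / 2)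
  -- The value of `√D` from which the bad coordinates number at most `ρ D / 2`.
  set X := 2 * B ^ 2 / (((1 - β₁) * ε / 2) ^ 2 * ρ)
  set c₃ := min (v * θ ^ 4 / (K / ε) ^ 2) (1 / X)
  set C₁ := 2 * K / √c₀ + K ^ 2 / c₀
  set C₂ := r₀ * (K / ε) / (v * θ ^ 2) + r₀ * X / √v
  have hv : 0 < v := by positivity
  have hX : 0 < X := by positivity
  have hc₁ : 0 < c₁ := by positivity
  have hc₂ : 0 < c₂ := by positivity
  have hc₃ : 0 < c₃ := lt_min (by positivity) (by positivity)
  have hC₁ : 0 < C₁ := by positivity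
  have hC₂ : 0 < C₂ := by positivity
  have hKε : 0 < K / ε := by positivity
  have hKc : 0 < K ^ 2 / c₀ := by positivity
  obtain ⟨c, hc, hcc₁, hcc₂, hcc₃⟩ : ∃ c, 0 < c ∧ c ≤ c₁ ∧ c ≤ c₂ ∧ c ≤ c₃ :=
    ⟨min c₁ (min c₂ c₃), lt_min hc₁ (lt_min hc₂ hc₃), min_le_left _ _,
      (min_le_right _ _).trans (min_le_left _ _), (min_le_right _ _).trans (min_le_right _ _)⟩
  obtain ⟨C, hC, hCK, hCB, hCKc, hCC₁, hCKε, hCC₂⟩ : ∃ C, 0 < C ∧ K ^ 2 ≤ C ∧ B ^ 2 ≤ C ∧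
      K ^ 2 / c₀ ≤ C ∧ C₁ ≤ C ∧ K / ε ≤ C ∧ C₂ ≤ C := by
    have := sq_nonneg K
    have := sq_nonneg B
    refine ⟨K ^ 2 + B ^ 2 + K ^ 2 / c₀ + C₁ + K / ε + C₂, ?_, ?_, ?_, ?_, ?_, ?_, ?_⟩ <;> linarith
  refine ⟨c, C, hc, hC, ?_⟩
  intro m n hm hn Ω mΩ μ _ ℱ Wstar W₀ S E σsq I η wd hS hE hI hW₀ hη _ D d h τ
  have hh : h.Valid := ⟨hη, hβ₁, hβ₁', hβ₂, hβ₂', hε⟩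
  have hm' : (1 : ℝ) ≤ m := by exact_mod_cast hm
  have hn' : (1 : ℝ) ≤ n := by exact_mod_cast hn
  have hd : 1 ≤ d := Nat.one_le_cast.2 (le_min hm hn)
  have hD0 : 0 < D := by positivity
  have hD : 1 ≤ √D := by
    rw [Real.one_le_sqrt]
    exact one_le_mul_of_one_le_of_one_le hm' hn'
  have hdQ : d * √D ≤ D := AdamEscape.min_mul_sqrt_le m n
  have hQ : √D * √D = D := Real.mul_self_sqrt hD0.le
  have hdD : d ≤ √D := le_of_mul_le_mul_right (hdQ.trans_eq hQ.symm) (by positivity)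
  have hd2 : d * d ≤ D := (mul_le_mul_of_nonneg_left hdD (by positivity)).trans hdQ
  have hSK : ∀ W, AdamEscape.frob (W - Wstar) < r₀ → ∀ i j, |S W i j| ≤ K / √D :=
    fun W hW i j => hS.abs_entry_le hW i j
  have hSK' : ∀ W, AdamEscape.frob (W - Wstar) < r₀ → ∀ i j, |S W i j| ≤ K :=
    fun W hW i j => (hSK W hW i j).trans (div_le_self hK.le hD)
  have hSsq : ∀ W, AdamEscape.frob (W - Wstar) < r₀ → ∀ i j, S W i j ^ 2 ≤ K ^ 2 / D := by
    intro W hW i j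
    rw [← sq_abs, ← Real.sq_sqrt hD0.le, ← div_pow]
    exact pow_le_pow_left₀ (abs_nonneg _) (hSK W hW i j) 2
  refine ⟨fun W hW i j => (hSsq W hW i j).trans (by gcongr), ?_, ?_, ?_, ?_, ?_⟩
  · rw [div_le_div_iff₀ hD0 (by positivity)]
    calc (∑ i, ∑ j, σsq i j) * d ≤ d * B ^ 2 * d := by
          gcongr
          exact hE.sum_σsq_le
      _ = B ^ 2 * (d * d) := by ring
      _ ≤ C * D := by gcongr
  · intro W hW p hp
    calc S W p.1 p.2 ^ 2 ≤ K ^ 2 / D := hSsq W hW _ _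
      _ ≤ K ^ 2 / (d * d) := by gcongr
      _ = K ^ 2 / c₀ / d * (c₀ / d) := by field_simp
      _ ≤ C / d * σsq p.1 p.2 := by
        gcongr
        exact hI.variance_ge p hp
  · intro p hp t ht
    have hσ : c₀ / d ≤ σsq p.1 p.2 := hI.variance_ge p hp
    have hσ0 : 0 ≤ σsq p.1 p.2 := hE.σsq_nonneg _ _
    -- From `t ≥ 1`, the start-up factor `1 - β₂ ^ t` is at least `1 - β₂`. In the relative error it
    -- appears on both sides and costs nothing.
    have hpow : β₂ ^ t ≤ β₂ := pow_le_of_le_one hβ₂ hβ₂'.le (by omega)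
    have hnn : 0 ≤ 1 - β₂ ^ t := by linarith
    rw [hE.lintegral_noiseV hh]
    refine ⟨ENNReal.ofReal_le_ofReal ?_, ?_⟩
    · calc c / d ≤ c₁ / d := by gcongr
        _ = (1 - β₂) * (c₀ / d) := mul_div_assoc _ _ _
        _ ≤ (1 - β₂ ^ t) * σsq p.1 p.2 := by gcongr
    · refine (hE.setLIntegral_abs_V_sub_le hh (by positivity : 0 ≤ K / √D) hSK t _ _).trans ?_
      rw [← ENNReal.ofReal_mul (by positivity)]
      refine ENNReal.ofReal_le_ofReal ?_
      calc (1 - β₂ ^ t) * (2 * (K / √D) * √(σsq p.1 p.2) + (K / √D) ^ 2)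
          ≤ (1 - β₂ ^ t) * (C₁ / √d * σsq p.1 p.2) :=
            mul_le_mul_of_nonneg_left (AdamEscape.relative_error_le hK.le hc₀ hd hdD hσ) hnn
        _ ≤ (1 - β₂ ^ t) * (C / √d * σsq p.1 p.2) := by gcongr
        _ = C / √d * ((1 - β₂ ^ t) * σsq p.1 p.2) := by ring
  · intro t
    refine ⟨ae_of_all _ fun ω hω => (AdamEscape.frob_sigStep_le hh hK.le hSK hω).trans ?_, ?_⟩
    · exact mul_le_mul_of_nonneg_right hCKε hη.le
    · refine le_trans ?_ (hE.le_setLIntegral_frob_noiseStep hh hS.measurable hB.le hK.le hSK' hI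
        hm hn hρ.le hc₀.le t)
      gcongr
  · intro hesc
    obtain ⟨h1, h2⟩ := hesc.bounds (v := v) (X := X) hh hK hSK hr₀ hθ hv hX hm hn hW₀
      (fun t => ℱ.le t _ (hE.measurableSet_lt_escapeTime hS.measurable t)) fun t ht =>
        hE.le_sum_condVar_noiseStep hh hS.measurable hB.le hK.le hSK' hI hm hn hρ.le hc₀.le t <| by
          refine ht.imp_right fun hle => ?_
          rwa [div_le_iff₀' (by positivity)] at hle
    refine ⟨h1.trans ?_, le_trans ?_ h2⟩
    · gcongr
    · exact ENNReal.ofReal_le_ofReal (mul_le_mul_of_nonneg_right hcc₃ (by positivity))
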